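/- Let $K\subset\mathbb R^d$ be compact, let $Y$ be a finite set, let $\Phi$ be a channel (Markov kernel) from $K$ to $Y$ with transition probabilities $\Phi(y|x)$, and let $\Delta=a(\Psi_1-\Psi_2)$, with $a\in\mathbb R$ and $\Psi_1,\Psi_2$ channels from $K$ to $Y$, be a tangent vector. Assume that $\Delta(y|x)=0$ whenever $\Phi(y|x)=0$ and that the score $L_x(y)=\Delta(y|x)/\Phi(y|x)$ has uniformly bounded fourth moments, $\sup_{x\in K}\sum_{y}\Phi(y|x)L_x(y)^4<\infty$. Assume also that there is a function $f$ with $\lim_{s\downarrow 0}f(s)=0$ and $$\max\{\|\Phi(\cdot|x)-\Phi(\cdot|x')\|_1,\ \|\Delta(\cdot|x)-\Delta(\cdot|x')\|_1\}\le f(\|x-x'\|)\qquad(x,x'\in K).$$ Notation. $J:=\sup_{x\in K}\sum_y \Delta(y|x)^2/\Phi(y|x)$ (terms with $\Phi(y|x)=0$ count as $0$). For $t>0$, $k_t$ is the number of points of the lattice $t\mathbb Z^d$ that are the closest lattice point (ties broken by rounding) of some $x\in K$. A lattice discretization of $K$ at scale $t$ is a measurable map $\rho:K\to K$ such that $\rho(x)$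 depends only on the closest lattice point $m(x)$ of $x$, $m(\rho(x))=m(x)$, and $\rho(x)=m(x)$ whenever $m(x)\in K$. For real $s\ge 0$ put $\{\mathrm N(0,1),\delta\mathrm N(0,1)\}^{\otimes s}:=\{\mathrm N(0,1),\sqrt s\,\delta\mathrm N(0,1)\}$, where $\delta\mathrm N(0,1)$ is the signed measure with density $z\,e^{-z^2/2}/\sqrt{2\pi}$. $\Delta^{(n)}:=\sum_{i=1}^n\Phi^{\otimes (i-1)}\otimes\Delta\otimes\Phi^{\otimes(n-i)}$. $\|D\|_{\mathrm{cb}}:=\sup_P\|(D\otimes\mathbf I)(P)\|_1$, the supremum being over probability measures $P$ on the product of the input space with an arbitrary ancillary measurable space, and $\|\cdot\|_1$ the total variation norm. Then there are $\{\Phi_t,\Delta_t\}_{t>0}$ of the form $\Phi_t(\cdot|x)=\Phi(\cdot|\rho_t(x))$, $\Delta_t(\cdot|x)=\Delta(\cdot|\rho_t(x))$ with $\rho_t$ a lattice discretization of $K$ at scale $t$, where $\Phi_t$ is a channel and $\Delta_t$ a tangent vector, with $$\lim_{t\downarrow0}\|\Phi_t-\Phi\|_{\mathrm{cb}}=\lim_{t\downarrow0}\|\Delta_t-\Delta\|_{\mathrm{cb}}=0,$$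 and real constants $C_t$ that do not depend on $\varepsilon$, $c$, $n$, such that $\lim_{t\downarrow0}C_t$ exists and is finite, with the following property. For all $\varepsilon,c>0$, $t>0$, $n\ge1$, with the program $$\{q^n_{\varepsilon,t},\delta^n_{\varepsilon,t}\}:=\{\mathrm N(0,1),\delta\mathrm N(0,1)\}^{\otimes n(1+k_t\varepsilon)(J+c)},$$ there is a Markov kernel $\Lambda^n_t$ from $K^n\times\mathbb R$ to $Y^n$ such that, as linear maps of the input $p$, $$\bigl\|\Phi_t^{\otimes n}(p)-\Lambda^n_t(p\otimes q^n_{\varepsilon,t})\bigr\|_{\mathrm{cb}}\le\frac{C_t}{\sqrt{\varepsilon n}},\qquad \frac1{\sqrt n}\bigl\|\Delta_t^{(n)}(p)-\Lambda^n_t(p\otimes\delta^n_{\varepsilon,t})\bigr\|_{\mathrm{cb}}\le\frac{C_t}{(\varepsilon n)^{1/4}}.$$ -/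

import Mathlib

open MeasureTheory ProbabilityTheory Filter Topology
open scoped ENNReal NNReal

/-! Channels with finite output set are Markov kernels `Φ : Kernel X Y` with `Y` finite; the number
`Φ(y|x)` is `prob Φ x y`. Linear maps from (signed) measures on `X` to signed measures on a finite
set `Y`, such as tangents `Δ` or differences of channels, are given by their transition functions
`D : X → Y → ℝ`, with `D x y` standing for `D(y|x)`. -/

section Channels

variable {X Y : Type*} [MeasurableSpace X] [MeasurableSpace Y]

/-- The transition probability `Φ(y|x)`. -/
noncomputable def prob (Φ : Kernel X Y) (x : X) (y : Y) : ℝ := (Φ x).real {y}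

/-- `Δ` is a tangent vector to the space of channels: `Δ = c (Ψ₁ - Ψ₂)` for a real number `c` and
channels `Ψ₁`, `Ψ₂`. -/
def IsTangent (Δ : X → Y → ℝ) : Prop :=
  ∃ (c : ℝ) (Ψ₁ Ψ₂ : Kernel X Y), IsMarkovKernel Ψ₁ ∧ IsMarkovKernel Ψ₂ ∧
    ∀ x y, Δ x y = c * (prob Ψ₁ x y - prob Ψ₂ x y)

variable [Fintype Y]

/-- The signed measure `(D ⊗ I)(P)` on `Y × Z`, for a probability measure `P` on `X × Z`. -/
noncomputable def tensorId {Z : Type*} [MeasurableSpace Z] (D : X → Y → ℝ)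
    (P : ProbabilityMeasure (X × Z)) : SignedMeasure (Y × Z) :=
  ∑ y, ((P : Measure (X × Z)).withDensityᵥ (fun w => D w.1 y)).map (fun w => (y, w.2))

/-- The completely bounded norm `‖D‖_cb`: the supremum of the total variation norm of
`(D ⊗ I)(P)`, over all ancillary measurable spaces `Z` and all probability measures `P` on
`X × Z`. -/
noncomputable def cbNorm (D : X → Y → ℝ) : ℝ≥0∞ :=
  ⨆ (Z : Type) (_ : MeasurableSpace Z) (P : ProbabilityMeasure (X × Z)),
    (tensorId D P).totalVariation Set.univ

/-- The Fisher information `J_p(δ) = ∑ δ(y)² / p(y)` on a finite set (used where `δ` vanishes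
at the zeros of `p`, so that such terms contribute `0`). -/
noncomputable def fisherInfo (p δ : Y → ℝ) : ℝ := ∑ y, δ y ^ 2 / p y

/-- The fourth moment `E_p L⁴` of the score `L = δ / p`. -/
noncomputable def scoreFourthMoment (p δ : Y → ℝ) : ℝ := ∑ y, p y * (δ y / p y) ^ 4

/-- `G^min_Φ(Δ) = sup_x J_{Φ(·|x)}(Δ(·|x))`. -/
noncomputable def gMin (Φ : Kernel X Y) (Δ : X → Y → ℝ) : ℝ :=
  ⨆ x, fisherInfo (prob Φ x) (Δ x)

end Channels

section TensorPowers

variable {X Y : Type*}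

/-- `Φ^{⊗n}(yⁿ|xⁿ) = ∏ᵢ Φ(yᵢ|xᵢ)`. -/
noncomputable def tensorPow (φ : X → Y → ℝ) (n : ℕ) (x : Fin n → X) (y : Fin n → Y) : ℝ :=
  ∏ i, φ (x i) (y i)

/-- `Δ^{(n)} = Δ ⊗ Φ^{⊗(n-1)} + Φ ⊗ Δ ⊗ Φ^{⊗(n-2)} + ⋯ + Φ^{⊗(n-1)} ⊗ Δ`. -/
noncomputable def tangentPow (φ Δ : X → Y → ℝ) (n : ℕ) (x : Fin n → X) (y : Fin n → Y) : ℝ :=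
  ∑ i, Δ (x i) (y i) * ∏ j ∈ Finset.univ.erase i, φ (x j) (y j)

end TensorPowers

section Program

/-- The Lebesgue density of the signed measure `δN(a, v)`. -/
noncomputable def gaussianTangent (a : ℝ) (v : ℝ≥0) (z : ℝ) : ℝ :=
  (z - a) / v * gaussianPDFReal a v z

/-- The density of the first member of the program `{N(0,1), δN(0,1)}^{⊗s}`, which for real
`s ≥ 0` is `{N(0,1), √s δN(0,1)}`. -/
noncomputable def programDensity (z : ℝ) : ℝ := gaussianPDFReal 0 1 z

/-- The density of the second member of the program `{N(0,1), δN(0,1)}^{⊗s}`. -/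
noncomputable def programTangent (s : ℝ) (z : ℝ) : ℝ := Real.sqrt s * gaussianTangent 0 1 z

/-- The transition function of the linear map `p ↦ Λ(p ⊗ r)`, where `r` is an integrable function
(density of a signed measure) on `ℝ`. -/
noncomputable def runProgram {A B : Type*} [MeasurableSpace A] [MeasurableSpace B]
    (Λ : Kernel (A × ℝ) B) (r : ℝ → ℝ) (a : A) (b : B) : ℝ :=
  ∫ z, prob Λ (a, z) b * r z

end Program

section Lattice

variable {d : ℕ}

/-- The integer vector `m` for which `t m` is the point of the lattice `t ℤ^d` closest to `x`
(ties are broken by rounding). -/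
noncomputable def latticeIndex (t : ℝ) (x : EuclideanSpace ℝ (Fin d)) : Fin d → ℤ :=
  fun i => round (x i / t)

/-- The point `t m` of the lattice `t ℤ^d`, whose minimal distance is `t`. -/
noncomputable def latticePoint (t : ℝ) (m : Fin d → ℤ) : EuclideanSpace ℝ (Fin d) :=
  WithLp.toLp 2 (fun i => t * m i)

/-- The number of points of `t ℤ^d` that are closest to some point of `K`
(finite for bounded `K` and `t > 0`). -/
noncomputable def latticeCount (K : Set (EuclideanSpace ℝ (Fin d))) (t : ℝ) : ℕ :=
  (latticeIndex t '' K).ncard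

/-- `ρ : K → K` sends each point of `K` to its closest point in the lattice `t ℤ^d`, if this lattice
point lies in `K`, and otherwise to a point of `K` that depends only on this lattice point and has
the same closest lattice point. -/
structure IsLatticeDiscretization (K : Set (EuclideanSpace ℝ (Fin d))) (t : ℝ) (ρ : K → K) :
    Prop where
  measurable : Measurable ρ
  index_eq : ∀ x : K, latticeIndex t (ρ x : EuclideanSpace ℝ (Fin d)) =
    latticeIndex t (x : EuclideanSpace ℝ (Fin d))
  eq_of_index_eq : ∀ x x' : K, latticeIndex t (x : EuclideanSpace ℝ (Fin d)) =
    latticeIndex t (x' : EuclideanSpace ℝ (Fin d)) → ρ x = ρ x'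
  eq_latticePoint : ∀ x : K, latticePoint t (latticeIndex t (x : EuclideanSpace ℝ (Fin d))) ∈ K →
    (ρ x : EuclideanSpace ℝ (Fin d)) =
      latticePoint t (latticeIndex t (x : EuclideanSpace ℝ (Fin d)))

end Lattice

/-! ### Gaussian moments and the expansion of a Gaussian-smoothed Lipschitz function -/

section GaussianSmoothing

local notation "γ" => gaussianReal 0 1

/-! The cb norm is at most the supremum over inputs of the `ℓ¹` norm (`cbNorm_le_ofReal`), so it
suffices to simulate, for each input string separately, the pair `(P, P·S)` from `(N(0,1), √s z
N(0,1))`. Here `P` is a product distribution, `S` the sum of the independent centred scores, of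
total variance `v ≤ nJ`, and `s ≥ n(1+ε)J`. After discretization only countably many strings of
lattice indices occur, so the separate simulations glue to a measurable kernel.

By Hahn-Banach separation (`exists_isRandomization_of_le`) a simulation exists as soon as every
linear decision problem has, up to a small error, at least as large a value on the Gaussian side. A
problem with payoffs `α y + β y * u` has the Gaussian value `E h(√s Z)`, where `h` is the maximum of
these affine functions: it is convex, and Lipschitz with constant `B` bounding `|β|`. On the other
side the payoff is at most `h(S)`, and by Jensen adding independent noise of variance `V` only
increases the value. Lindeberg replacement (`exists_gaussian_replacement_sum`) turns `S + √V Z` into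
a Gaussian of variance `V + v` at cost `O(n B R / V)`. The excess `ε` of Fisher information leaves
room for `V` of order `nεJ`; for very small `ε` more noise is added and its effect is paid for by
the Lipschitz bound (`exists_noise_level`). This is `exists_product_le_gaussian`.

The error involves `β` only, so the tangent carries all of it, while `P` itself is matched to any
prescribed positive accuracy. -/

lemma integrable_exp_mul_abs_gaussianReal (c : ℝ) :
    Integrable (fun z : ℝ => Real.exp (c * |z|)) γ := by
  refine Integrable.mono' ((integrable_exp_mul_gaussianReal (μ := 0) (v := 1) c).add
    (integrable_exp_mul_gaussianReal (μ := 0) (v := 1) (-c))) (by fun_prop) (ae_of_all _ fun z => ?_)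
  rw [Real.norm_eq_abs, Real.abs_exp, Pi.add_apply]
  rcases abs_cases z with ⟨h, -⟩ | ⟨h, -⟩ <;> rw [h]
  · have := Real.exp_pos (-c * z); linarith
  · have := Real.exp_pos (c * z)
    have h2 : c * -z = -c * z := by ring
    rw [h2]; linarith

lemma abs_pow_le_factorial_mul_exp (k : ℕ) (z : ℝ) : |z| ^ k ≤ k.factorial * Real.exp |z| := by
  have h := Real.pow_div_factorial_le_exp |z| (abs_nonneg z) k
  rwa [div_le_iff₀ (by positivity), mul_comm] at h

lemma integrable_abs_pow_mul_exp_gaussianReal (k : ℕ) (c : ℝ) :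
    Integrable (fun z : ℝ => |z| ^ k * Real.exp (c * |z|)) γ := by
  refine Integrable.mono' ((integrable_exp_mul_abs_gaussianReal (1 + c)).const_mul k.factorial)
    (by fun_prop) (ae_of_all _ fun z => ?_)
  rw [Real.norm_eq_abs, abs_of_nonneg (by positivity), add_mul, Real.exp_add, one_mul, ← mul_assoc]
  exact mul_le_mul_of_nonneg_right (abs_pow_le_factorial_mul_exp k z) (Real.exp_pos _).le

lemma integrable_abs_pow_gaussianReal (k : ℕ) : Integrable (fun z : ℝ => |z| ^ k) γ := by
  simpa using integrable_abs_pow_mul_exp_gaussianReal k 0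

lemma integrable_pow_gaussianReal (k : ℕ) : Integrable (fun z : ℝ => z ^ k) γ :=
  (integrable_abs_pow_gaussianReal k).mono (by fun_prop) (ae_of_all _ fun z => by simp)

lemma integral_sq_gaussianReal : ∫ z, z ^ 2 ∂γ = 1 := by
  have h := variance_fun_id_gaussianReal (μ := 0) (v := 1)
  rw [variance_eq_integral (by fun_prop)] at h
  simpa using h

lemma integral_abs_gaussianReal_le : ∫ z, |z| ∂γ ≤ 1 := by
  have h : ∫ z, |z| ∂γ ≤ ∫ z, (1 + z ^ 2) / 2 ∂γ := by
    refine integral_mono ?_ ?_ fun z => ?_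
    · simpa using integrable_abs_pow_gaussianReal 1
    · exact ((integrable_const _).add (integrable_pow_gaussianReal 2)).div_const 2
    · show |z| ≤ (1 + z ^ 2) / 2
      nlinarith [sq_abs z, sq_nonneg (|z| - 1)]
  rw [integral_div, integral_add (integrable_const _) (integrable_pow_gaussianReal 2),
    integral_sq_gaussianReal] at h
  simpa using h

lemma LipschitzWith.abs_sub_le {B : ℝ≥0} {g : ℝ → ℝ} (hg : LipschitzWith B g) (u v : ℝ) :
    |g u - g v| ≤ B * |u - v| := by
  simpa [Real.dist_eq] using hg.dist_le_mul u v

lemma LipschitzWith.comp_affine {B : ℝ≥0} {g : ℝ → ℝ} (hg : LipschitzWith B g) (c : ℝ) {r : ℝ}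
    (hr : 0 ≤ r) : LipschitzWith (B * r.toNNReal) (fun z => g (c + r * z)) := by
  refine LipschitzWith.of_dist_le_mul fun u v => ?_
  rw [Real.dist_eq, Real.dist_eq, NNReal.coe_mul, Real.coe_toNNReal r hr]
  refine (hg.abs_sub_le _ _).trans (le_of_eq ?_)
  rw [show c + r * u - (c + r * v) = r * (u - v) by ring, abs_mul, abs_of_nonneg hr, mul_assoc]

lemma LipschitzWith.integrable_gaussianReal {B : ℝ≥0} {g : ℝ → ℝ} (hg : LipschitzWith B g) :
    Integrable g γ := by
  refine Integrable.mono' ((integrable_const |g 0|).add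
    ((integrable_abs_pow_gaussianReal 1).const_mul B))
    hg.continuous.measurable.aestronglyMeasurable (ae_of_all _ fun z => ?_)
  have h1 := hg.abs_sub_le z 0
  have h2 := abs_sub_abs_le_abs_sub (g z) (g 0)
  simp only [Real.norm_eq_abs, Pi.add_apply, pow_one]
  rw [sub_zero] at h1
  linarith

/-- Translating the standard Gaussian measure multiplies it by an exponential density. -/
lemma integral_add_gaussianReal (g : ℝ → ℝ) (x : ℝ) :
    ∫ z, g (x + z) ∂γ = ∫ z, g z * Real.exp (z * x - x ^ 2 / 2) ∂γ := by
  rw [integral_gaussianReal_eq_integral_smul one_ne_zero,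
    integral_gaussianReal_eq_integral_smul one_ne_zero,
    ← integral_add_left_eq_self (fun z => gaussianPDFReal 0 1 z • (g z * _)) x]
  refine integral_congr_ae (ae_of_all _ fun z => ?_)
  simp only [gaussianPDFReal, smul_eq_mul]
  have : Real.exp (-(z - 0) ^ 2 / (2 * ((1 : ℝ≥0) : ℝ))) =
      Real.exp (-(x + z - 0) ^ 2 / (2 * ((1 : ℝ≥0) : ℝ))) *
        Real.exp ((x + z) * x - x ^ 2 / 2) := by
    rw [← Real.exp_add]; congr 1; push_cast; ring
  rw [this]; ring

lemma abs_exp_sub_quadratic_le (y : ℝ) :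
    |Real.exp y - (1 + y + y ^ 2 / 2)| ≤ |y| ^ 3 * Real.exp |y| := by
  have h := Complex.norm_exp_sub_sum_le_norm_mul_exp (y : ℂ) 3
  simp only [Finset.sum_range_succ, Finset.sum_range_zero, Nat.factorial, zero_add, pow_zero,
    pow_one] at h
  rw [Complex.norm_real, Real.norm_eq_abs] at h
  refine le_of_eq_of_le ?_ h
  rw [← Real.norm_eq_abs, ← Complex.norm_real]
  congr 1
  push_cast
  norm_num

/-- Second order Taylor expansion in `y = z * x - x ^ 2 / 2`. The quadratic polynomial in `y`
differs from the Hermite expansion in `x` only by `-z x³/2 + x⁴/8`; this and the Taylor remainder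
each contribute at most `6 |x|³ exp (2(|z|+1))`. -/
lemma abs_shift_density_sub_quadratic_le {x : ℝ} (hx : |x| ≤ 1) (z : ℝ) :
    |Real.exp (z * x - x ^ 2 / 2) - (1 + x * z + x ^ 2 * ((z ^ 2 - 1) / 2))| ≤
      |x| ^ 3 * (12 * Real.exp (2 * (|z| + 1))) := by
  set w := |z| + 1 with hw
  have hw1 : 1 ≤ w := by have := abs_nonneg z; linarith
  have hx0 := abs_nonneg x
  set y := z * x - x ^ 2 / 2 with hy
  have hyw : |y| ≤ |x| * w := by
    refine (abs_sub _ _).trans ?_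
    rw [abs_mul, abs_of_nonneg (by positivity : (0 : ℝ) ≤ x ^ 2 / 2), ← sq_abs x, hw]
    nlinarith
  have hyw' : |y| ≤ w := hyw.trans (by nlinarith)
  have h1 : |Real.exp y - (1 + y + y ^ 2 / 2)| ≤ |x| ^ 3 * (w ^ 3 * Real.exp w) := by
    refine (abs_exp_sub_quadratic_le y).trans ?_
    rw [← mul_assoc, ← mul_pow]
    gcongr
  have h2 : |-(z * x ^ 3) / 2 + x ^ 4 / 8| ≤ |x| ^ 3 * w := by
    refine (abs_add_le _ _).trans ?_
    rw [abs_div, abs_neg, abs_mul, abs_pow, abs_div, abs_pow]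
    norm_num
    have : |x| ^ 4 ≤ |x| ^ 3 := pow_le_pow_of_le_one hx0 hx (by norm_num)
    have h3 : 0 ≤ |x| ^ 3 := by positivity
    have := mul_nonneg (abs_nonneg z) h3
    rw [hw]
    linarith
  have h3 : w ≤ w ^ 3 * Real.exp w := by
    have he : 1 ≤ Real.exp w := Real.one_le_exp (by linarith)
    have : w ≤ w ^ 3 := le_self_pow₀ hw1 (by norm_num)
    nlinarith
  have h4 : w ^ 3 * Real.exp w ≤ 6 * Real.exp (2 * w) := by
    have := abs_pow_le_factorial_mul_exp 3 w
    rw [abs_of_nonneg (by linarith : 0 ≤ w)] at this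
    norm_num [Nat.factorial] at this
    rw [two_mul, Real.exp_add w w, ← mul_assoc]
    exact mul_le_mul_of_nonneg_right this (Real.exp_pos _).le
  have hsplit : Real.exp y - (1 + x * z + x ^ 2 * ((z ^ 2 - 1) / 2)) =
      (Real.exp y - (1 + y + y ^ 2 / 2)) + (-(z * x ^ 3) / 2 + x ^ 4 / 8) := by
    rw [hy]; ring
  rw [hsplit]
  refine (abs_add_le _ _).trans ((add_le_add h1 h2).trans ?_)
  rw [← mul_add]
  gcongr
  linarith

/-- The Gaussian smoothing of a Lipschitz function has a second order expansion with a cubic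
remainder. -/
lemma exists_quadratic_approx_gaussianReal : ∃ C : ℝ, 0 ≤ C ∧ ∀ (B : ℝ≥0) (g : ℝ → ℝ),
    LipschitzWith B g → ∃ a₀ a b : ℝ, ∀ x,
      |∫ z, g (x + z) ∂γ - (a₀ + a * x + b * x ^ 2)| ≤ C * B * |x| ^ 3 := by
  set C₁ := ∫ z, |z| * (12 * Real.exp (2 * (|z| + 1))) ∂γ with hC₁
  set C₂ := ∫ z, |z| * |(z ^ 2 - 1) / 2| ∂γ with hC₂
  have hC₁0 : 0 ≤ C₁ := integral_nonneg fun z => by positivity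
  have hC₂0 : 0 ≤ C₂ := integral_nonneg fun z => by positivity
  -- `C₁` serves `|x| ≤ 1`; the terms `1`, `1`, `C₂` bound the increment, the linear and the
  -- quadratic term when `|x| > 1`.
  refine ⟨C₁ + (1 + 1 + C₂), by linarith, fun B g hg => ?_⟩
  have hm : Measurable g := hg.continuous.measurable
  -- Removing `g 0` gives `|k z| ≤ B |z|`, so that every bound is proportional to `B`.
  set k : ℝ → ℝ := fun z => g z - g 0 with hk
  have hkm : Measurable k := hm.sub_const _
  have hkb : ∀ z, |k z| ≤ B * |z| := fun z => by simpa using hg.abs_sub_le z 0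
  have hkL : LipschitzWith B k := by
    refine LipschitzWith.of_dist_le_mul fun u v => ?_
    simpa [hk, Real.dist_eq] using hg.abs_sub_le u v
  have hkx : ∀ x, Integrable (fun z => k (x + z)) γ := fun x => by
    simpa using (hkL.comp_affine x zero_le_one).integrable_gaussianReal
  have hi0 : Integrable k γ := hkL.integrable_gaussianReal
  have hz2 : Integrable (fun z : ℝ => |z| * |z|) γ := by
    simpa [sq] using integrable_abs_pow_gaussianReal 2
  have hi1 : Integrable (fun z => k z * z) γ := by
    refine Integrable.mono' (hz2.const_mul B) (by fun_prop) (ae_of_all _ fun z => ?_)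
    rw [Real.norm_eq_abs, abs_mul, ← mul_assoc]
    exact mul_le_mul_of_nonneg_right (hkb z) (abs_nonneg z)
  have hz3 : Integrable (fun z : ℝ => |z| * |(z ^ 2 - 1) / 2|) γ := by
    refine Integrable.mono' ((integrable_abs_pow_gaussianReal 3).add
      (integrable_abs_pow_gaussianReal 1)) (by fun_prop) (ae_of_all _ fun z => ?_)
    rw [Real.norm_eq_abs, abs_mul, abs_abs, abs_abs, Pi.add_apply, abs_div]
    have : |z ^ 2 - 1| ≤ |z| ^ 2 + 1 := (abs_sub _ _).trans (by simp)
    have h0 := abs_nonneg z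
    norm_num
    nlinarith [abs_nonneg (z ^ 2 - 1), mul_le_mul_of_nonneg_left this h0]
  have hi2 : Integrable (fun z => k z * ((z ^ 2 - 1) / 2)) γ := by
    refine Integrable.mono' (hz3.const_mul B) (by fun_prop) (ae_of_all _ fun z => ?_)
    rw [Real.norm_eq_abs, abs_mul, ← mul_assoc]
    exact mul_le_mul_of_nonneg_right (hkb z) (abs_nonneg _)
  have hz4 : Integrable (fun z : ℝ => |z| * (12 * Real.exp (2 * (|z| + 1)))) γ := by
    refine ((integrable_abs_pow_mul_exp_gaussianReal 1 2).const_mul (12 * Real.exp 2)).congr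
      (ae_of_all _ fun z => ?_)
    simp only [pow_one]
    rw [mul_add, Real.exp_add, mul_one]; ring
  -- Hermite coefficients: the shift is moved onto the Gaussian density, which is smooth even though
  -- `g` is not.
  refine ⟨g 0 + ∫ z, k z ∂γ, ∫ z, k z * z ∂γ, ∫ z, k z * ((z ^ 2 - 1) / 2) ∂γ, fun x => ?_⟩
  have hgk : ∫ z, g (x + z) ∂γ = g 0 + ∫ z, k (x + z) ∂γ := by
    have : (fun z => g (x + z)) = fun z => g 0 + k (x + z) := by ext z; simp [hk]
    rw [this, integral_add (integrable_const _) (hkx x)]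
    simp
  rw [hgk]
  set a₀ := ∫ z, k z ∂γ
  set a := ∫ z, k z * z ∂γ
  set b := ∫ z, k z * ((z ^ 2 - 1) / 2) ∂γ
  have hB := B.coe_nonneg
  rw [show g 0 + ∫ z, k (x + z) ∂γ - (g 0 + a₀ + a * x + b * x ^ 2) =
    ∫ z, k (x + z) ∂γ - (a₀ + a * x + b * x ^ 2) by ring]
  rcases le_or_gt |x| 1 with hx | hx
  · have hexp : Integrable (fun z => k z * Real.exp (z * x - x ^ 2 / 2)) γ := by
      refine Integrable.mono' (((integrable_abs_pow_mul_exp_gaussianReal 1 1).const_mul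
        (B * Real.exp 0))) (by fun_prop) (ae_of_all _ fun z => ?_)
      rw [Real.norm_eq_abs, abs_mul, Real.abs_exp, Real.exp_zero, mul_one, pow_one, one_mul,
        ← mul_assoc]
      refine mul_le_mul (hkb z) (Real.exp_le_exp.2 ?_) (Real.exp_pos _).le (by positivity)
      have : z * x ≤ |z| * |x| := by rw [← abs_mul]; exact le_abs_self _
      nlinarith [abs_nonneg z, sq_nonneg x]
    have heq : ∫ z, k (x + z) ∂γ - (a₀ + a * x + b * x ^ 2) =
        ∫ z, k z * (Real.exp (z * x - x ^ 2 / 2) - (1 + x * z + x ^ 2 * ((z ^ 2 - 1) / 2))) ∂γ := by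
      have h2 : ∀ z, k z * (Real.exp (z * x - x ^ 2 / 2) -
          (1 + x * z + x ^ 2 * ((z ^ 2 - 1) / 2))) = k z * Real.exp (z * x - x ^ 2 / 2) -
          ((k z + k z * z * x) + k z * ((z ^ 2 - 1) / 2) * x ^ 2) := fun z => by ring
      have h3 : Integrable (fun z => k z + k z * z * x) γ := hi0.add (hi1.mul_const x)
      have h4 : Integrable (fun z => k z + k z * z * x + k z * ((z ^ 2 - 1) / 2) * x ^ 2) γ :=
        h3.add (hi2.mul_const _)
      simp_rw [h2]
      rw [integral_sub hexp h4, integral_add h3 (hi2.mul_const _),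
        integral_add hi0 (hi1.mul_const x), integral_mul_const, integral_mul_const,
        integral_add_gaussianReal]
    rw [heq]
    have hle : |∫ z, k z * (Real.exp (z * x - x ^ 2 / 2) -
        (1 + x * z + x ^ 2 * ((z ^ 2 - 1) / 2))) ∂γ| ≤
        ∫ z, B * |x| ^ 3 * (|z| * (12 * Real.exp (2 * (|z| + 1)))) ∂γ := by
      rw [← Real.norm_eq_abs]
      refine norm_integral_le_of_norm_le (hz4.const_mul _) (ae_of_all _ fun z => ?_)
      rw [Real.norm_eq_abs, abs_mul]
      refine (mul_le_mul (hkb z) (abs_shift_density_sub_quadratic_le hx z) (abs_nonneg _)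
        (by positivity)).trans (le_of_eq (by ring))
    rw [integral_const_mul] at hle
    refine hle.trans ?_
    have h3 : 0 ≤ B * |x| ^ 3 := by positivity
    nlinarith [mul_nonneg h3 hC₂0]
  · have ha : |a| ≤ B := by
      have : |a| ≤ ∫ z, B * (z ^ 2) ∂γ := by
        rw [← Real.norm_eq_abs]
        refine norm_integral_le_of_norm_le ((integrable_pow_gaussianReal 2).const_mul _)
          (ae_of_all _ fun z => ?_)
        rw [Real.norm_eq_abs, abs_mul, ← sq_abs z, sq, ← mul_assoc]
        exact mul_le_mul_of_nonneg_right (hkb z) (abs_nonneg z)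
      rwa [integral_const_mul, integral_sq_gaussianReal, mul_one] at this
    have hb : |b| ≤ B * C₂ := by
      rw [hC₂, ← integral_const_mul, ← Real.norm_eq_abs]
      refine norm_integral_le_of_norm_le (hz3.const_mul _) (ae_of_all _ fun z => ?_)
      rw [Real.norm_eq_abs, abs_mul, ← mul_assoc]
      exact mul_le_mul_of_nonneg_right (hkb z) (abs_nonneg _)
    have h0 : |∫ z, k (x + z) ∂γ - a₀| ≤ B * |x| := by
      rw [← integral_sub (hkx x) hi0, ← Real.norm_eq_abs]
      refine (norm_integral_le_of_norm_le (integrable_const (B * |x|))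
        (ae_of_all _ fun z => ?_)).trans (by simp)
      simpa using hkL.abs_sub_le (x + z) z
    have h1 : |x| ≤ |x| ^ 3 := le_self_pow₀ hx.le (by norm_num)
    have h2 : |x| ^ 2 ≤ |x| ^ 3 := pow_le_pow_right₀ hx.le (by norm_num)
    have : |∫ z, k (x + z) ∂γ - (a₀ + a * x + b * x ^ 2)| ≤
        B * |x| + B * |x| + B * C₂ * |x| ^ 2 := by
      rw [show ∫ z, k (x + z) ∂γ - (a₀ + a * x + b * x ^ 2) =
        (∫ z, k (x + z) ∂γ - a₀) + -(a * x) + -(b * x ^ 2) by ring]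
      refine (abs_add_three _ _ _).trans ?_
      rw [abs_neg, abs_neg, abs_mul, abs_mul, abs_pow]
      gcongr
    have e1 := mul_le_mul_of_nonneg_left h1 hB
    have e2 := mul_le_mul_of_nonneg_left h2 (mul_nonneg hB hC₂0)
    have e3 : 0 ≤ C₁ * B * |x| ^ 3 := by positivity
    nlinarith

end GaussianSmoothing

/-! ### Lindeberg replacement in the presence of Gaussian noise -/

section Replacement

local notation "γ" => gaussianReal 0 1

lemma gaussianReal_map_mul_sqrt (a : ℝ) (v : ℝ) (hv : v = a ^ 2) :
    (γ).map (fun z => a * z) = gaussianReal 0 v.toNNReal := by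
  rw [gaussianReal_map_const_mul]
  congr 1
  · simp
  · rw [mul_one]; ext; subst hv; simp [sq_nonneg]

/-- The sum of independent centred Gaussian variables is Gaussian. -/
lemma integral_integral_gaussianReal {B : ℝ≥0} {h : ℝ → ℝ} (hh : LipschitzWith B h) {u v w : ℝ}
    (hw : 0 ≤ w) (huv : u ^ 2 + v ^ 2 = w ^ 2) :
    ∫ z, ∫ z', h (u * z + v * z') ∂γ ∂γ = ∫ z, h (w * z) ∂γ := by
  have hu : Measurable fun z : ℝ => u * z := by fun_prop
  have hv : Measurable fun z : ℝ => v * z := by fun_prop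
  have hw' : Measurable fun z : ℝ => w * z := by fun_prop
  have hhm := hh.continuous.measurable
  have hconv : (γ).map (fun z => u * z) ∗ (γ).map (fun z => v * z) = (γ).map (fun z => w * z) := by
    rw [gaussianReal_map_mul_sqrt u _ rfl, gaussianReal_map_mul_sqrt v _ rfl,
      gaussianReal_map_mul_sqrt w _ rfl, gaussianReal_conv_gaussianReal,
      ← Real.toNNReal_add (sq_nonneg _) (sq_nonneg _), huv, add_zero]
  have hint : Integrable h ((γ).map (fun z => w * z)) := by
    rw [integrable_map_measure hhm.aestronglyMeasurable hw'.aemeasurable]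
    have hi := (hh.comp_affine 0 hw).integrable_gaussianReal
    simp only [zero_add] at hi
    exact hi
  have hsf : SFinite ((γ).map (fun z => u * z)) := inferInstance
  have hsf : SFinite ((γ).map (fun z => v * z)) := inferInstance
  have h1 := integral_conv (μ := (γ).map (fun z => u * z)) (ν := (γ).map (fun z => v * z))
    (f := h) (by rw [hconv]; exact hint)
  rw [hconv, integral_map hw'.aemeasurable hhm.aestronglyMeasurable,
    integral_map hu.aemeasurable] at h1
  · rw [h1]
    refine integral_congr_ae (ae_of_all _ fun z => ?_)
    simp only
    have hz : Measurable fun x => h (u * z + x) := hhm.comp (measurable_const_add (u * z))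
    rw [integral_map hv.aemeasurable hz.aestronglyMeasurable]
  · refine StronglyMeasurable.aestronglyMeasurable ?_
    exact StronglyMeasurable.integral_prod_right
      (f := fun a b : ℝ => h (a + b)) (hhm.comp measurable_add).stronglyMeasurable

/-- Replacing a centred finitely supported variable by a Gaussian one of the same variance, in the
presence of independent Gaussian noise of variance `V`. -/
lemma exists_gaussian_replacement : ∃ C : ℝ, 0 ≤ C ∧ ∀ (B : ℝ≥0) (h : ℝ → ℝ), LipschitzWith B h →
    ∀ {Y : Type*} [Fintype Y] (p L : Y → ℝ) (R V : ℝ), 0 < V → (∀ y, 0 ≤ p y) → ∑ y, p y = 1 →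
    ∑ y, p y * L y = 0 → ∑ y, p y * |L y| ^ 3 ≤ R →
    √(∑ y, p y * L y ^ 2) ^ 3 ≤ R → ∀ c : ℝ,
    ∑ y, p y * ∫ z, h (c + L y + √V * z) ∂γ ≤
      ∫ z, h (c + √(V + ∑ y, p y * L y ^ 2) * z) ∂γ + C * B * R / V := by
  obtain ⟨C, hC0, hC⟩ := exists_quadratic_approx_gaussianReal
  set M := ∫ z, |z| ^ 3 ∂γ with hM
  have hM0 : 0 ≤ M := integral_nonneg fun z => by positivity
  refine ⟨C * (1 + M), by positivity, fun B h hh Y _ p L R V hV hp hp1 hL0 hR hτR c => ?_⟩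
  set σ := √V with hσ
  have hσ0 : 0 < σ := Real.sqrt_pos.2 hV
  have hσV : σ ^ 2 = V := Real.sq_sqrt hV.le
  set v := ∑ y, p y * L y ^ 2 with hv
  have hv0 : 0 ≤ v := Finset.sum_nonneg fun y _ => mul_nonneg (hp y) (sq_nonneg _)
  set τ := √v with hτ
  have hτ0 : 0 ≤ τ := Real.sqrt_nonneg _
  have hτv : τ ^ 2 = v := Real.sq_sqrt hv0
  -- Rescaling to unit noise multiplies the Lipschitz constant by `σ` and divides the shift by `σ`;
  -- the cubic remainder thus scales as `σ / σ³ = 1 / V`.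
  obtain ⟨a₀, a, b, hab⟩ := hC (B * σ.toNNReal) (fun z => h (c + σ * z)) (hh.comp_affine c hσ0.le)
  set G : ℝ → ℝ := fun x => ∫ z, h (c + x + σ * z) ∂γ with hG
  have hGx : ∀ x, |G x - (a₀ + a / σ * x + b / V * x ^ 2)| ≤ C * B / V * |x| ^ 3 := by
    intro x
    have h1 := hab (x / σ)
    have h2 : ∀ z, h (c + σ * (x / σ + z)) = h (c + x + σ * z) := fun z => by
      congr 1; field_simp; ring
    simp_rw [h2] at h1
    rw [abs_div, abs_of_pos hσ0, NNReal.coe_mul, Real.coe_toNNReal _ hσ0.le] at h1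
    rw [← hσV]
    convert h1 using 1
    · congr 2; field_simp
    · field_simp
  -- The quadratic part sees only mass, mean and variance, which the Gaussian `τ Z` shares; only the
  -- two third moments remain as error.
  have hsum : ∑ y, p y * G (L y) ≤ a₀ + b / V * v + C * B / V * R := by
    have h1 : ∀ y, p y * G (L y) ≤ p y * a₀ + a / σ * (p y * L y) + b / V * (p y * L y ^ 2) +
        C * B / V * (p y * |L y| ^ 3) := fun y => by
      have := mul_le_mul_of_nonneg_left (abs_le.1 (hGx (L y))).2 (hp y)
      nlinarith
    refine (Finset.sum_le_sum fun y _ => h1 y).trans ?_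
    rw [Finset.sum_add_distrib, Finset.sum_add_distrib, Finset.sum_add_distrib, ← Finset.sum_mul,
      ← Finset.mul_sum, ← Finset.mul_sum, ← Finset.mul_sum, hp1, hL0]
    have : 0 ≤ C * B / V := by positivity
    nlinarith [mul_le_mul_of_nonneg_left hR this]
  have hconv : ∫ z, G (τ * z) ∂γ = ∫ z, h (c + √(V + v) * z) ∂γ := by
    have hh' : LipschitzWith B fun z => h (c + z) := by
      simpa using hh.comp_affine c zero_le_one
    rw [← integral_integral_gaussianReal hh' (u := τ) (v := σ) (Real.sqrt_nonneg _)
      (by rw [hτv, hσV, Real.sq_sqrt (by positivity), add_comm])]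
    simp only [hG, add_assoc]
  have hlow : Integrable (fun z : ℝ => a₀ + a / σ * τ * z + b / V * v * z ^ 2 -
      C * B / V * τ ^ 3 * |z| ^ 3) γ := by
    have h1 := (integrable_pow_gaussianReal 1).const_mul (a / σ * τ)
    simp only [pow_one] at h1
    exact (((integrable_const a₀).add h1).add
      ((integrable_pow_gaussianReal 2).const_mul (b / V * v))).sub
      ((integrable_abs_pow_gaussianReal 3).const_mul (C * B / V * τ ^ 3))
  have hGi : Integrable (fun z => G (τ * z)) γ := by
    have hh' : LipschitzWith B G := by
      refine LipschitzWith.of_dist_le_mul fun x y => ?_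
      have hi : ∀ x, Integrable (fun z => h (c + x + σ * z)) γ := fun x =>
        (hh.comp_affine (c + x) hσ0.le).integrable_gaussianReal
      rw [dist_eq_norm, hG, ← integral_sub (hi x) (hi y)]
      refine (norm_integral_le_of_norm_le (integrable_const (B * dist x y))
        (ae_of_all _ fun z => ?_)).trans (by simp)
      rw [Real.norm_eq_abs, Real.dist_eq]
      refine (hh.abs_sub_le _ _).trans (le_of_eq (by ring_nf))
    simpa using (hh'.comp_affine 0 hτ0).integrable_gaussianReal
  have hgauss : a₀ + b / V * v - C * B / V * τ ^ 3 * M ≤ ∫ z, G (τ * z) ∂γ := by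
    have h1 : ∫ z, (a₀ + a / σ * τ * z + b / V * v * z ^ 2 -
        C * B / V * τ ^ 3 * |z| ^ 3) ∂γ ≤ ∫ z, G (τ * z) ∂γ := by
      refine integral_mono hlow hGi fun z => ?_
      have := (abs_le.1 (hGx (τ * z))).1
      rw [abs_mul, abs_of_nonneg hτ0, mul_pow, mul_pow, hτv] at this
      linarith
    refine le_of_eq_of_le ?_ h1
    have i1 : Integrable (fun z : ℝ => a / σ * τ * z) γ := by
      simpa using (integrable_pow_gaussianReal 1).const_mul (a / σ * τ)
    have i2 : Integrable (fun z : ℝ => a₀ + a / σ * τ * z) γ := (integrable_const _).add i1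
    have i3 := (integrable_pow_gaussianReal 2).const_mul (b / V * v)
    have i4 : Integrable (fun z : ℝ => a₀ + a / σ * τ * z + b / V * v * z ^ 2) γ := i2.add i3
    rw [integral_sub i4 ((integrable_abs_pow_gaussianReal 3).const_mul _), integral_add i2 i3,
      integral_add (integrable_const _) i1, integral_const_mul, integral_const_mul,
      integral_const_mul, integral_sq_gaussianReal, integral_id_gaussianReal]
    simp [hM]
  rw [← hconv]
  have hk : C * B / V * τ ^ 3 * M ≤ C * B / V * R * M := by gcongr
  have : C * (1 + M) * B * R / V = C * B / V * R + C * B / V * R * M := by ring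
  linarith

/-- Lindeberg replacement for a sum of independent centred finitely supported variables. -/
lemma exists_gaussian_replacement_sum : ∃ C : ℝ, 0 ≤ C ∧ ∀ (B : ℝ≥0) (h : ℝ → ℝ),
    LipschitzWith B h → ∀ {Y : Type*} [Fintype Y] (R : ℝ) (n : ℕ) (p L : Fin n → Y → ℝ) (V : ℝ),
    0 < V → (∀ i y, 0 ≤ p i y) → (∀ i, ∑ y, p i y = 1) →
    (∀ i, ∑ y, p i y * L i y = 0) → (∀ i, ∑ y, p i y * |L i y| ^ 3 ≤ R) →
    (∀ i, √(∑ y, p i y * L i y ^ 2) ^ 3 ≤ R) →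
    ∑ y : Fin n → Y, (∏ i, p i (y i)) * ∫ z, h (∑ i, L i (y i) + √V * z) ∂γ ≤
      ∫ z, h (√(V + ∑ i, ∑ y, p i y * L i y ^ 2) * z) ∂γ + n * (C * B * R / V) := by
  obtain ⟨C, hC0, hC⟩ := exists_gaussian_replacement
  refine ⟨C, hC0, fun B h hh Y _ R n => ?_⟩
  induction n with
  | zero => intro p L V hV _ _ _ _ _; simp
  | succ n ih =>
    intro p L V hV hp hp1 hL hR hτ
    have hR0 : 0 ≤ R := (by positivity : (0 : ℝ) ≤ _).trans (hτ 0)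
    set v := ∑ y, p 0 y * L 0 y ^ 2 with hv
    have hv0 : 0 ≤ v := Finset.sum_nonneg fun y _ => mul_nonneg (hp 0 y) (sq_nonneg _)
    -- Once Gaussian, the first summand joins the noise. The noise level only grows, so each
    -- replacement costs at most `C * B * R / V`.
    have hih := ih (fun i => p i.succ) (fun i => L i.succ) (V + v) (by linarith)
      (fun i => hp _) (fun i => hp1 _) (fun i => hL _) (fun i => hR _) (fun i => hτ _)
    have hprod1 : ∑ y : Fin n → Y, ∏ i, p i.succ (y i) = 1 := by
      rw [← Fintype.piFinset_univ, ← Finset.prod_univ_sum]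
      exact Finset.prod_eq_one fun i _ => hp1 _
    have hstep : ∀ y : Fin n → Y, ∑ y₀, p 0 y₀ * ∫ z, h (L 0 y₀ + ∑ i, L i.succ (y i) + √V * z) ∂γ
        ≤ ∫ z, h (∑ i, L i.succ (y i) + √(V + v) * z) ∂γ + C * B * R / V := fun y => by
      simp_rw [add_comm (L 0 _)]
      exact hC B h hh (p 0) (L 0) R V hV (hp 0) (hp1 0) (hL 0) (hR 0) (hτ 0) _
    rw [← (Fin.consEquiv fun _ => Y).sum_comp, Fintype.sum_prod_type_right]
    simp only [Fin.consEquiv_apply, Fin.prod_univ_succ, Fin.sum_univ_succ, Fin.cons_zero,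
      Fin.cons_succ]
    calc _ = ∑ y : Fin n → Y, (∏ i, p i.succ (y i)) *
          ∑ y₀, p 0 y₀ * ∫ z, h (L 0 y₀ + ∑ i, L i.succ (y i) + √V * z) ∂γ := by
            refine Finset.sum_congr rfl fun y _ => ?_
            rw [Finset.mul_sum]
            exact Finset.sum_congr rfl fun y₀ _ => by ring
      _ ≤ ∑ y : Fin n → Y, (∏ i, p i.succ (y i)) *
          (∫ z, h (∑ i, L i.succ (y i) + √(V + v) * z) ∂γ + C * B * R / V) :=
            Finset.sum_le_sum fun y _ => mul_le_mul_of_nonneg_left (hstep y)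
              (Finset.prod_nonneg fun i _ => hp _ _)
      _ = ∑ y : Fin n → Y, (∏ i, p i.succ (y i)) *
          (∫ z, h (∑ i, L i.succ (y i) + √(V + v) * z) ∂γ) + C * B * R / V := by
            simp_rw [mul_add]
            rw [Finset.sum_add_distrib, ← Finset.sum_mul, hprod1, one_mul]
      _ ≤ _ := by
            rw [← hv, ← add_assoc]
            have : C * B * R / (V + v) ≤ C * B * R / V := by gcongr; linarith
            have := mul_le_mul_of_nonneg_left this (Nat.cast_nonneg (α := ℝ) n)
            push_cast
            linarith

end Replacement

/-! ### Randomization criterion by convex separation -/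

section Randomization

variable {Ω : Type*} [Fintype Ω]

/-- A randomized decision on the finite set `Ω`: measurable weights that sum to one. -/
structure IsRandomization (w : Ω → ℝ → ℝ) : Prop where
  measurable : ∀ y, Measurable (w y)
  nonneg : ∀ y z, 0 ≤ w y z
  sum_eq_one : ∀ z, ∑ y, w y z = 1

lemma IsRandomization.le_one {w : Ω → ℝ → ℝ} (hw : IsRandomization w) (y : Ω) (z : ℝ) :
    w y z ≤ 1 := by
  rw [← hw.sum_eq_one z]
  exact Finset.single_le_sum (f := fun y => w y z) (fun y _ => hw.nonneg y z) (Finset.mem_univ y)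

lemma IsRandomization.integrable_mul {w : Ω → ℝ → ℝ} (hw : IsRandomization w) {μ : Measure ℝ}
    {T : ℝ → ℝ} (hT : Integrable T μ) (y : Ω) : Integrable (fun z => w y z * T z) μ := by
  refine hT.bdd_mul (c := 1) (hw.measurable y).aestronglyMeasurable (ae_of_all _ fun z => ?_)
  rw [Real.norm_eq_abs, abs_of_nonneg (hw.nonneg y z)]
  exact hw.le_one y z

lemma IsRandomization.integrable {w : Ω → ℝ → ℝ} (hw : IsRandomization w) {μ : Measure ℝ}
    [IsFiniteMeasure μ] (y : Ω) : Integrable (w y) μ := by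
  simpa using hw.integrable_mul (integrable_const (1 : ℝ)) y

lemma IsRandomization.convexComb {w w' : Ω → ℝ → ℝ} (hw : IsRandomization w)
    (hw' : IsRandomization w') {a b : ℝ} (ha : 0 ≤ a) (hb : 0 ≤ b) (hab : a + b = 1) :
    IsRandomization fun y z => a * w y z + b * w' y z where
  measurable y := ((hw.measurable y).const_mul a).add ((hw'.measurable y).const_mul b)
  nonneg y z := add_nonneg (mul_nonneg ha (hw.nonneg y z)) (mul_nonneg hb (hw'.nonneg y z))
  sum_eq_one z := by
    rw [Finset.sum_add_distrib, ← Finset.mul_sum, ← Finset.mul_sum, hw.sum_eq_one,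
      hw'.sum_eq_one, mul_one, mul_one, hab]

/-- The maximum of finitely many measurable functions is attained by a randomized decision. -/
lemma exists_isRandomization_sum_eq_sup' [Nonempty Ω] (l : Ω → ℝ → ℝ) (hl : ∀ y, Measurable (l y)) :
    ∃ w : Ω → ℝ → ℝ, IsRandomization w ∧ ∀ z,
      ∑ y, w y z * l y z = Finset.univ.sup' Finset.univ_nonempty fun y => l y z := by
  classical
  -- Ties are split uniformly: `A y` is where `y` is a maximizer and `N z` counts the maximizers at
  -- `z`.
  set A : Ω → Set ℝ := fun y => {z | ∀ y', l y' z ≤ l y z} with hA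
  have hAm : ∀ y, MeasurableSet (A y) := fun y => by
    have : A y = ⋂ y', {z | l y' z ≤ l y z} := by ext; simp [hA]
    rw [this]
    exact MeasurableSet.iInter fun y' => measurableSet_le (hl y') (hl y)
  set N : ℝ → ℝ := fun z => ∑ y, (A y).indicator 1 z with hN
  have hi0 : ∀ y z, 0 ≤ (A y).indicator (1 : ℝ → ℝ) z := fun y z =>
    Set.indicator_nonneg (fun _ _ => zero_le_one) z
  have hN0 : ∀ z, 0 < N z := fun z => by
    obtain ⟨y, -, hy⟩ := Finset.exists_max_image Finset.univ (fun y => l y z) Finset.univ_nonempty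
    refine Finset.sum_pos' (fun y _ => hi0 y z) ⟨y, Finset.mem_univ y, ?_⟩
    have : z ∈ A y := fun y' => hy y' (Finset.mem_univ _)
    simp [this]
  refine ⟨fun y z => (A y).indicator 1 z / N z, ⟨fun y => ?_, fun y z => ?_, fun z => ?_⟩,
    fun z => ?_⟩
  · have h1 : ∀ y, Measurable ((A y).indicator (1 : ℝ → ℝ)) := fun y =>
      measurable_one.indicator (hAm y)
    exact (h1 y).div (Finset.measurable_fun_sum _ fun y _ => h1 y)
  · exact div_nonneg (hi0 y z) (hN0 z).le
  · rw [← Finset.sum_div]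
    exact div_self (hN0 z).ne'
  · set m := Finset.univ.sup' Finset.univ_nonempty fun y => l y z with hm
    have h1 : ∀ y, (A y).indicator 1 z / N z * l y z = (A y).indicator 1 z / N z * m := fun y => by
      by_cases hz : z ∈ A y
      · have : l y z = m := le_antisymm (Finset.le_sup' (fun y => l y z) (Finset.mem_univ y))
          (Finset.sup'_le _ _ fun y' _ => hz y')
        rw [this]
      · simp [hz]
    rw [Finset.sum_congr rfl fun y _ => h1 y, ← Finset.sum_mul, ← Finset.sum_div,
      div_self (hN0 z).ne', one_mul]

lemma convex_setOf_sum_abs_lt (E : ℝ) : Convex ℝ {v : Ω → ℝ | ∑ y, |v y| < E} := by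
  intro u hu v hv a b ha hb hab
  show ∑ y, |a * u y + b * v y| < E
  replace hu : ∑ y, |u y| < E := hu
  replace hv : ∑ y, |v y| < E := hv
  have h1 : ∑ y, |a * u y + b * v y| ≤ a * ∑ y, |u y| + b * ∑ y, |v y| := by
    rw [Finset.mul_sum, Finset.mul_sum, ← Finset.sum_add_distrib]
    refine Finset.sum_le_sum fun y _ => (abs_add_le _ _).trans ?_
    rw [abs_mul, abs_mul, abs_of_nonneg ha, abs_of_nonneg hb]
  refine h1.trans_lt ?_
  rcases ha.eq_or_lt with rfl | ha
  · rw [zero_add] at hab; subst hab; simpa using hv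
  · have e1 := mul_lt_mul_of_pos_left hu ha
    have e2 := mul_le_mul_of_nonneg_left hv.le hb
    have e3 : a * E + b * E = E := by rw [← add_mul, hab, one_mul]
    linarith

open scoped Pointwise in
/-- If the values of all linear decision problems on the target pair `(p, δ)` are dominated, up to
`D`, by the values of the same problems on the pair `(μ, T μ)`, then the target pair can
approximately be obtained from `(μ, T μ)` by a randomization. -/
theorem exists_isRandomization_of_le [Nonempty Ω] (μ : Measure ℝ) [IsFiniteMeasure μ] (T : ℝ → ℝ)
    (hTm : Measurable T) (hT : Integrable T μ) (p δ : Ω → ℝ) {D E₁ E₂ : ℝ} (hD : 0 ≤ D)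
    (hE₁ : 0 < E₁) (hE₂ : D < E₂)
    (H : ∀ (α β : Ω → ℝ) (B : ℝ≥0), (∀ y, |β y| ≤ B) → ∑ y, (α y * p y + β y * δ y) ≤
      ∫ z, Finset.univ.sup' Finset.univ_nonempty (fun y => α y + β y * T z) ∂μ + B * D) :
    ∃ w : Ω → ℝ → ℝ, IsRandomization w ∧ ∑ y, |p y - ∫ z, w y z ∂μ| ≤ E₁ ∧
      ∑ y, |δ y - ∫ z, w y z * T z ∂μ| ≤ E₂ := by
  classical
  set F : (Ω → ℝ → ℝ) → (Ω → ℝ) × (Ω → ℝ) := fun w =>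
    (fun y => ∫ z, w y z ∂μ, fun y => ∫ z, w y z * T z ∂μ) with hF
  set A : Set ((Ω → ℝ) × (Ω → ℝ)) := F '' {w | IsRandomization w} with hA
  set U : Set ((Ω → ℝ) × (Ω → ℝ)) := {v | ∑ y, |v y| < E₁} ×ˢ {v | ∑ y, |v y| < E₂} with hU
  have hUo : IsOpen U := IsOpen.prod (isOpen_lt (by fun_prop) continuous_const)
    (isOpen_lt (by fun_prop) continuous_const)
  have hUc : Convex ℝ U := (convex_setOf_sum_abs_lt E₁).prod (convex_setOf_sum_abs_lt E₂)
  have hAc : Convex ℝ A := by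
    rintro _ ⟨w, hw, rfl⟩ _ ⟨w', hw', rfl⟩ a b ha hb hab
    refine ⟨_, hw.convexComb hw' ha hb hab, ?_⟩
    simp only [hF]
    ext y
    · simp only [Prod.fst_add, Prod.smul_fst, Pi.add_apply, Pi.smul_apply, smul_eq_mul]
      rw [integral_add ((hw.integrable y).const_mul a) ((hw'.integrable y).const_mul b),
        integral_const_mul, integral_const_mul]
    · simp only [Prod.snd_add, Prod.smul_snd, Pi.add_apply, Pi.smul_apply, smul_eq_mul, add_mul,
        mul_assoc]
      rw [integral_add ((hw.integrable_mul hT y).const_mul a)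
        ((hw'.integrable_mul hT y).const_mul b), integral_const_mul, integral_const_mul]
  by_cases hmem : (p, δ) ∈ A + U
  · obtain ⟨_, ⟨w, hw, rfl⟩, u, hu, hpu⟩ := Set.mem_add.1 hmem
    have h1 : ∀ y, p y - ∫ z, w y z ∂μ = u.1 y := fun y => by
      have := congrFun (congrArg Prod.fst hpu) y
      simp only [hF, Prod.fst_add, Pi.add_apply] at this
      linarith
    have h2 : ∀ y, δ y - ∫ z, w y z * T z ∂μ = u.2 y := fun y => by
      have := congrFun (congrArg Prod.snd hpu) y
      simp only [hF, Prod.snd_add, Pi.add_apply] at this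
      linarith
    refine ⟨w, hw, ?_, ?_⟩
    · simp_rw [h1]; exact hu.1.le
    · simp_rw [h2]; exact hu.2.le
  -- A separating functional is a decision problem `(α, β)` whose value at the target exceeds its
  -- value on all of `A + U`, against `H`.
  · obtain ⟨φ, hφ⟩ := geometric_hahn_banach_open_point (hAc.add hUc) hUo.add_left hmem
    set α : Ω → ℝ := fun y => φ (Pi.single y 1, 0) with hα
    set β : Ω → ℝ := fun y => φ (0, Pi.single y 1) with hβ
    have hφe : ∀ u v : Ω → ℝ, φ (u, v) = ∑ y, (α y * u y + β y * v y) := fun u v => by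
      have h1 : (u, v) = ∑ y, (u y • ((Pi.single y 1, 0) : (Ω → ℝ) × (Ω → ℝ)) +
          v y • ((0, Pi.single y 1) : (Ω → ℝ) × (Ω → ℝ))) := by
        ext i
        · simp [Prod.fst_sum, Finset.sum_apply, Pi.single_apply]
        · simp [Prod.snd_sum, Finset.sum_apply, Pi.single_apply]
      rw [h1, map_sum]
      exact Finset.sum_congr rfl fun y _ => by
        rw [map_add, map_smul, map_smul, smul_eq_mul, smul_eq_mul, mul_comm, mul_comm (v y)]
    obtain ⟨w, hw, hwm⟩ := exists_isRandomization_sum_eq_sup' (fun y z => α y + β y * T z)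
      (fun y => by fun_prop)
    obtain ⟨y₀, -, hy₀⟩ := Finset.exists_max_image Finset.univ (fun y => |β y|)
      Finset.univ_nonempty
    have hval : φ (F w) = ∫ z, Finset.univ.sup' Finset.univ_nonempty
        (fun y => α y + β y * T z) ∂μ := by
      simp_rw [hF, hφe, ← hwm]
      rw [integral_finsetSum]
      · refine Finset.sum_congr rfl fun y _ => ?_
        rw [← integral_const_mul, ← integral_const_mul, ← integral_add
          ((hw.integrable y).const_mul _) ((hw.integrable_mul hT y).const_mul _)]
        exact integral_congr_ae (ae_of_all _ fun z => by ring)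
      · exact fun y _ => hw.integrable_mul ((integrable_const _).add (hT.const_mul _)) y
    -- This tolerance vector has `ℓ¹` norm at most `D`, hence lies in the open set since `D < E₂`,
    -- and it gains exactly the error `D * max |β|` allowed in `H`.
    set e : Ω → ℝ := Pi.single y₀ (D * SignType.sign (β y₀)) with he
    have heU : ((0 : Ω → ℝ), e) ∈ U := by
      refine ⟨by simpa using hE₁, ?_⟩
      have : ∑ y, |e y| = |D * SignType.sign (β y₀)| := by
        rw [Finset.sum_eq_single y₀]
        · simp [he]
        · intro y _ hy; simp [he, hy]
        · simp
      show ∑ y, |e y| < E₂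
      rw [this, abs_mul, abs_of_nonneg hD]
      refine lt_of_le_of_lt (mul_le_of_le_one_right hD ?_) hE₂
      rcases lt_trichotomy (β y₀) 0 with h | h | h <;> simp [h]
    have h1 := hφ (F w + (0, e)) (Set.add_mem_add ⟨w, hw, rfl⟩ heU)
    have hee : φ (0, e) = D * |β y₀| := by
      rw [hφe, Finset.sum_eq_single y₀]
      · simp only [he, Pi.zero_apply, mul_zero, zero_add, Pi.single_eq_same]
        rw [mul_left_comm, self_mul_sign]
      · intro y _ hy; simp [he, hy]
      · simp
    rw [map_add, hee, hval, hφe] at h1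
    have h2 := H α β (Real.nnabs (β y₀)) fun y => hy₀ y (Finset.mem_univ y)
    rw [Real.coe_nnabs, mul_comm |β y₀|] at h2
    linarith

end Randomization

/-! ### Comparison of a product experiment with a Gaussian shift -/

section ProductScore

local notation "γ" => gaussianReal 0 1

lemma lipschitzWith_sup'_affine {Ω : Type*} [Fintype Ω] [Nonempty Ω] (α β : Ω → ℝ) (B : ℝ≥0)
    (hβ : ∀ y, |β y| ≤ B) :
    LipschitzWith B fun u => Finset.univ.sup' Finset.univ_nonempty fun y => α y + β y * u := by
  set h : ℝ → ℝ := fun u => Finset.univ.sup' Finset.univ_nonempty fun y => α y + β y * u with hh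
  have key : ∀ u v, h u ≤ h v + B * |u - v| := fun u v => by
    refine Finset.sup'_le _ _ fun y _ => ?_
    have h1 : α y + β y * v ≤ h v :=
      Finset.le_sup' (fun y => α y + β y * v) (Finset.mem_univ y)
    have h2 : β y * (u - v) ≤ B * |u - v| := by
      refine (le_abs_self _).trans ?_
      rw [abs_mul]
      exact mul_le_mul_of_nonneg_right (hβ y) (abs_nonneg _)
    linarith
  refine LipschitzWith.of_dist_le_mul fun u v => ?_
  rw [Real.dist_eq, Real.dist_eq, abs_le]
  have h1 := key u v
  have h2 := key v u
  rw [abs_sub_comm] at h2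
  constructor <;> linarith

/-- Follows from `√(s + η) - √s ≤ √η` and `E|Z| ≤ 1`; it removes the surplus noise at the end of the
comparison. -/
lemma integral_lipschitz_scale_le {B : ℝ≥0} {h : ℝ → ℝ} (hh : LipschitzWith B h) {s η : ℝ}
    (hs : 0 ≤ s) (hη : 0 ≤ η) :
    ∫ z, h (√(s + η) * z) ∂γ ≤ ∫ z, h (√s * z) ∂γ + B * √η := by
  have hle : √s ≤ √(s + η) := Real.sqrt_le_sqrt (by linarith)
  have hsub : √(s + η) - √s ≤ √η := by
    rw [sub_le_iff_le_add', Real.sqrt_le_iff]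
    refine ⟨by positivity, ?_⟩
    nlinarith [Real.sq_sqrt hs, Real.sq_sqrt hη, Real.sqrt_nonneg s, Real.sqrt_nonneg η]
  have hi : ∀ r : ℝ, 0 ≤ r → Integrable (fun z => h (r * z)) γ := fun r hr => by
    have := (hh.comp_affine 0 hr).integrable_gaussianReal
    simpa only [zero_add] using this
  have habs : Integrable (fun z : ℝ => |z|) γ := by
    simpa using integrable_abs_pow_gaussianReal 1
  have h1 : ∫ z, h (√(s + η) * z) ∂γ ≤ ∫ z, (h (√s * z) + B * √η * |z|) ∂γ := by
    refine integral_mono (hi _ (Real.sqrt_nonneg _))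
      ((hi _ (Real.sqrt_nonneg _)).add (habs.const_mul _)) fun z => ?_
    have h2 := (le_abs_self _).trans (hh.abs_sub_le (√(s + η) * z) (√s * z))
    rw [← sub_mul, abs_mul, abs_of_nonneg (sub_nonneg.2 hle), ← mul_assoc] at h2
    have h3 : B * (√(s + η) - √s) * |z| ≤ B * √η * |z| := by gcongr
    linarith
  rw [integral_add (hi _ (Real.sqrt_nonneg _)) (habs.const_mul _), integral_const_mul] at h1
  have h4 : B * √η * ∫ z, |z| ∂γ ≤ B * √η :=
    mul_le_of_le_one_right (by positivity) integral_abs_gaussianReal_le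
  linarith

/-- The amount of additional noise to be used in the smoothing step. -/
lemma exists_noise_level {n ε : ℝ} (hn : 0 < n) (hε : 0 < ε) : ∃ a : ℝ, 0 ≤ a ∧
    n / (n * ε + a) ≤ √n / (ε * n) ^ (1 / 4 : ℝ) ∧ √a ≤ √n / (ε * n) ^ (1 / 4 : ℝ) := by
  set q := √n / (ε * n) ^ (1 / 4 : ℝ) with hq
  have hq0 : 0 < q := by positivity
  have hq4 : q ^ 4 = n / ε := by
    rw [hq, div_pow, ← Real.rpow_natCast ((ε * n) ^ (1 / 4 : ℝ)), ← Real.rpow_mul (by positivity),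
      show √n ^ 4 = (√n ^ 2) ^ 2 by ring, Real.sq_sqrt hn.le]
    norm_num
    field_simp
  rcases le_or_gt 1 (ε ^ 3 * n) with h | h
  -- Since `q ^ 4 = n / ε`, the bound `1 / ε ≤ q` is equivalent to `1 ≤ ε ^ 3 * n`. In the other
  -- case `a = n ^ (2/3)` makes both quantities at most `n ^ (1/3) ≤ q`.
  · refine ⟨0, le_rfl, ?_, by simpa using hq0.le⟩
    refine le_of_pow_le_pow_left₀ four_ne_zero hq0.le ?_
    rw [hq4, add_zero, div_mul_cancel_left₀ hn.ne', inv_pow, inv_le_iff_one_le_mul₀' (by positivity)]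
    refine h.trans (le_of_eq ?_)
    field_simp
  · set r := n ^ (1 / 3 : ℝ) with hr
    have hr0 : 0 < r := by positivity
    have hr3 : r ^ 3 = n := by
      rw [hr, ← Real.rpow_natCast, ← Real.rpow_mul hn.le]; norm_num
    have hrε : ε * r ≤ 1 := by
      refine le_of_pow_le_pow_left₀ three_ne_zero zero_le_one ?_
      rw [mul_pow, hr3, one_pow]; exact h.le
    have hrq : r ≤ q := by
      refine le_of_pow_le_pow_left₀ four_ne_zero hq0.le ?_
      rw [hq4, le_div_iff₀ hε, ← hr3]
      have : r ^ 4 * ε = r ^ 3 * (ε * r) := by ring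
      rw [this]
      exact mul_le_of_le_one_right (by positivity) hrε
    refine ⟨r ^ 2, by positivity, le_trans ?_ hrq, by rwa [Real.sqrt_sq hr0.le]⟩
    rw [div_le_iff₀ (by positivity), ← hr3]
    have : 0 ≤ r * (r ^ 3 * ε) := by positivity
    nlinarith

/-- Linear decision problems on a product experiment, with its score, are dominated up to a small
error by those on a Gaussian shift whose Fisher information is slightly larger. -/
theorem exists_product_le_gaussian : ∃ C : ℝ, 0 ≤ C ∧ ∀ {Y : Type*} [Fintype Y] (n : ℕ)
    [Nonempty (Fin n → Y)] (p L : Fin n → Y → ℝ) (J R ε s : ℝ), 0 < n → 0 ≤ J → 0 < ε →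
    n * (1 + ε) * J ≤ s → (∀ i y, 0 ≤ p i y) → (∀ i, ∑ y, p i y = 1) →
    (∀ i, ∑ y, p i y * L i y = 0) → (∀ i, ∑ y, p i y * |L i y| ^ 3 ≤ R) →
    (∀ i, ∑ y, p i y * L i y ^ 2 ≤ J) → √J ^ 3 ≤ R →
    ∀ (α β : (Fin n → Y) → ℝ) (B : ℝ≥0), (∀ y, |β y| ≤ B) →
      ∑ y, (α y * (∏ i, p i (y i)) + β y * ((∏ i, p i (y i)) * ∑ i, L i (y i))) ≤
        ∫ z, Finset.univ.sup' Finset.univ_nonempty (fun y => α y + β y * (√s * z)) ∂γ +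
          B * ((C * R / J + √J) * (√n / (ε * n) ^ (1 / 4 : ℝ))) := by
  obtain ⟨C, hC0, hC⟩ := exists_gaussian_replacement_sum
  refine ⟨C, hC0, fun {Y} _ n _ p L J R ε s hn hJ hε hs hp hp1 hL hR hLJ hJR α β B hβ => ?_⟩
  set h : ℝ → ℝ := fun u => Finset.univ.sup' Finset.univ_nonempty fun y => α y + β y * u with hh
  have hhL : LipschitzWith B h := lipschitzWith_sup'_affine α β B hβ
  have hP0 : ∀ y : Fin n → Y, 0 ≤ ∏ i, p i (y i) := fun y => Finset.prod_nonneg fun i _ => hp _ _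
  -- Jensen for a maximum of affine functions: centred noise leaves each affine mean unchanged.
  have haff : ∀ (v l : ℝ) (y : Fin n → Y), 0 ≤ v → α y + β y * l ≤ ∫ z, h (l + v * z) ∂γ := by
    intro v l y hv
    have hz : Integrable (fun z : ℝ => z) γ := by simpa using integrable_pow_gaussianReal 1
    have i1 : Integrable (fun z : ℝ => l + v * z) γ := (integrable_const _).add (hz.const_mul _)
    have h1 : ∫ z, (α y + β y * (l + v * z)) ∂γ = α y + β y * l := by
      rw [integral_add (integrable_const _) (i1.const_mul _), integral_const_mul,
        integral_add (integrable_const _) (hz.const_mul _), integral_const_mul,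
        integral_id_gaussianReal]
      simp
    rw [← h1]
    refine integral_mono ((integrable_const _).add (i1.const_mul _))
      (hhL.comp_affine l hv).integrable_gaussianReal fun z => ?_
    exact Finset.le_sup' (fun y => α y + β y * (l + v * z)) (Finset.mem_univ y)
  have hn' : (0 : ℝ) < n := Nat.cast_pos.2 hn
  have hs0 : 0 ≤ s := le_trans (by positivity) hs
  -- For `J = 0` the score vanishes almost surely and the error term is `0` (with `R / 0 = 0`), so
  -- Jensen alone suffices.
  rcases hJ.eq_or_lt with rfl | hJ
  · have hpL : ∀ i y, p i y * L i y = 0 := fun i y => by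
      have h1 : ∀ y, 0 ≤ p i y * L i y ^ 2 := fun y => mul_nonneg (hp i y) (sq_nonneg _)
      have h2 := (Finset.sum_eq_zero_iff_of_nonneg fun y _ => h1 y).1
        (le_antisymm (hLJ i) (Finset.sum_nonneg fun y _ => h1 y)) y (Finset.mem_univ y)
      rcases mul_eq_zero.1 h2 with h3 | h3
      · rw [h3, zero_mul]
      · rw [pow_eq_zero_iff two_ne_zero] at h3; rw [h3, mul_zero]
    have h1 : ∀ y : Fin n → Y, (∏ i, p i (y i)) * ∑ i, L i (y i) = 0 := fun y => by
      rw [Finset.mul_sum]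
      refine Finset.sum_eq_zero fun i _ => ?_
      rw [← Finset.mul_prod_erase _ _ (Finset.mem_univ i), mul_right_comm, hpL, zero_mul]
    have h2 : ∑ y : Fin n → Y, ∏ i, p i (y i) = 1 := by
      rw [← Fintype.piFinset_univ, ← Finset.prod_univ_sum]
      exact Finset.prod_eq_one fun i _ => hp1 _
    simp only [h1, mul_zero, add_zero, div_zero, Real.sqrt_zero, zero_mul]
    have h3 : ∀ y, α y * (∏ i, p i (y i)) ≤ (∫ z, h (√s * z) ∂γ) * ∏ i, p i (y i) := fun y => by
      refine mul_le_mul_of_nonneg_right ?_ (hP0 y)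
      simpa using haff (√s) 0 y (Real.sqrt_nonneg _)
    refine (Finset.sum_le_sum fun y _ => h3 y).trans ?_
    rw [← Finset.mul_sum, h2, mul_one]
  obtain ⟨a, ha0, ha1, ha2⟩ := exists_noise_level hn' hε
  set q := √n / (ε * n) ^ (1 / 4 : ℝ) with hq
  set v := ∑ i, ∑ y, p i y * L i y ^ 2 with hv
  have hvJ : v ≤ n * J := by
    refine (Finset.sum_le_sum fun i _ => hLJ i).trans ?_
    simp
  -- Chosen so that the variance after replacement is `s + J * a`, while `V ≥ J * (n * ε + a)`.
  set V := s - v + J * a with hV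
  have hVJ : J * (n * ε + a) ≤ V := by rw [hV]; nlinarith
  have hna : 0 < n * ε + a := by positivity
  have hV0 : 0 < V := lt_of_lt_of_le (by positivity) hVJ
  have hR0 : 0 ≤ R := le_trans (by positivity) hJR
  have hτ : ∀ i, √(∑ y, p i y * L i y ^ 2) ^ 3 ≤ R := fun i => by
    refine le_trans ?_ hJR
    gcongr
    exact hLJ i
  have hlin := hC B h hhL R n p L V hV0 hp hp1 hL hR hτ
  rw [← hv, show V + v = s + J * a by rw [hV]; ring] at hlin
  have hscale := integral_lipschitz_scale_le hhL hs0 (mul_nonneg hJ.le ha0)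
  have hstart : ∑ y, (α y * (∏ i, p i (y i)) + β y * ((∏ i, p i (y i)) * ∑ i, L i (y i))) ≤
      ∑ y : Fin n → Y, (∏ i, p i (y i)) * ∫ z, h (∑ i, L i (y i) + √V * z) ∂γ := by
    refine Finset.sum_le_sum fun y _ => ?_
    have := mul_le_mul_of_nonneg_left (haff (√V) (∑ i, L i (y i)) y (Real.sqrt_nonneg _)) (hP0 y)
    linarith
  have hB := B.coe_nonneg
  have e1 : n * (C * B * R / V) ≤ B * (C * R / J * q) := by
    calc n * (C * B * R / V) ≤ n * (C * B * R / (J * (n * ε + a))) := by gcongr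
      _ = B * (C * R / J * (n / (n * ε + a))) := by field_simp
      _ ≤ B * (C * R / J * q) := by gcongr
  have e2 : B * √(J * a) ≤ B * (√J * q) := by
    rw [Real.sqrt_mul hJ.le]
    gcongr
  have e3 : B * ((C * R / J + √J) * q) = B * (C * R / J * q) + B * (√J * q) := by ring
  rw [e3]
  linarith

end ProductScore

/-! ### Bounding the cb norm by pointwise `ℓ¹` norms -/

section CbNorm

variable {X Y : Type*} [MeasurableSpace X] [MeasurableSpace Y]

/-- On a Hahn decomposition the total variation is attained as `s i - s iᶜ`. -/
lemma totalVariation_univ_le {α : Type*} [MeasurableSpace α] (s : SignedMeasure α) {E : ℝ}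
    (h : ∀ A, MeasurableSet A → s A - s Aᶜ ≤ E) :
    s.totalVariation Set.univ ≤ ENNReal.ofReal E := by
  obtain ⟨i, hi₁, hi₂, hi₃, hp, hn⟩ := s.toJordanDecomposition_spec
  have h2 : s iᶜ ≤ 0 := s.nonpos_of_restrict_le_zero hi₃
  have h1 : 0 ≤ s i := s.nonneg_of_zero_le_restrict hi₂
  rw [SignedMeasure.totalVariation, Measure.add_apply, hp, hn,
    SignedMeasure.toMeasureOfZeroLE_apply _ hi₂ hi₁ MeasurableSet.univ,
    SignedMeasure.toMeasureOfLEZero_apply _ hi₃ hi₁.compl MeasurableSet.univ]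
  simp only [Set.inter_univ]
  refine le_trans (le_of_eq ?_) (ENNReal.ofReal_le_ofReal (h i hi₁))
  rw [sub_eq_add_neg, ENNReal.ofReal_add h1 (by linarith)]
  congr 1
  · rw [ENNReal.ofReal_eq_coe_nnreal h1]
  · rw [ENNReal.ofReal_eq_coe_nnreal (by linarith : 0 ≤ -s iᶜ)]

lemma withDensityᵥ_map_sub_le {Z : Type*} [MeasurableSpace Z] (μ : Measure (X × Z))
    (g : X × Z → ℝ) (y : Y) {A : Set (Y × Z)} (hA : MeasurableSet A) :
    ((μ.withDensityᵥ g).map fun w => (y, w.2)) A -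
      ((μ.withDensityᵥ g).map fun w => (y, w.2)) Aᶜ ≤ ∫ w, |g w| ∂μ := by
  have hm : Measurable fun w : X × Z => (y, w.2) := by fun_prop
  rw [VectorMeasure.map_apply _ hm hA, VectorMeasure.map_apply _ hm hA.compl, Set.preimage_compl]
  set S := (fun w : X × Z => (y, w.2)) ⁻¹' A
  have hS : MeasurableSet S := hm hA
  by_cases hg : Integrable g μ
  · rw [withDensityᵥ_apply hg hS, withDensityᵥ_apply hg hS.compl,
      ← integral_add_compl hS hg.abs]
    have h1 : ∫ w in S, g w ∂μ ≤ ∫ w in S, |g w| ∂μ :=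
      (le_abs_self _).trans abs_integral_le_integral_abs
    have h2 : -∫ w in Sᶜ, g w ∂μ ≤ ∫ w in Sᶜ, |g w| ∂μ :=
      (neg_le_abs _).trans abs_integral_le_integral_abs
    linarith
  · simp only [Measure.withDensityᵥ, hg, dite_false, zero_apply, sub_self]
    exact integral_nonneg fun w => abs_nonneg _

variable [Fintype Y]

/-- The completely bounded norm is dominated by the supremum of the `ℓ¹` norms. -/
lemma cbNorm_le_ofReal (D : X → Y → ℝ) {E : ℝ} (hE : ∀ x, ∑ y, |D x y| ≤ E)
    (hD : ∀ y, Measurable fun x => D x y) :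
    cbNorm D ≤ ENNReal.ofReal E := by
  refine iSup_le fun Z => iSup_le fun _ => iSup_le fun P => ?_
  refine totalVariation_univ_le _ fun A hA => ?_
  have hi : ∀ y, Integrable (fun w : X × Z => |D w.1 y|) (P : Measure (X × Z)) := fun y => by
    refine (integrable_const E).mono' ((hD y).comp measurable_fst).abs.aestronglyMeasurable
      (ae_of_all _ fun w => ?_)
    rw [Real.norm_eq_abs, abs_abs]
    exact (Finset.single_le_sum (f := fun y => |D w.1 y|) (fun y _ => abs_nonneg _)
      (Finset.mem_univ y)).trans (hE w.1)
  have h1 : ∀ A : Set (Y × Z), tensorId D P A =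
      ∑ y, (((P : Measure (X × Z)).withDensityᵥ (fun w => D w.1 y)).map fun w => (y, w.2)) A :=
    fun A => by
      rw [tensorId, ← FunLike.coeAddMonoidHom_apply, map_sum, Finset.sum_apply]
      rfl
  rw [h1, h1, ← Finset.sum_sub_distrib]
  refine (Finset.sum_le_sum fun y _ => withDensityᵥ_map_sub_le _ _ y hA).trans ?_
  rw [← integral_finsetSum _ fun y _ => hi y]
  refine (integral_mono (integrable_finsetSum _ fun y _ => hi y) (integrable_const E)
    fun w => hE w.1).trans ?_
  simp

end CbNorm

/-! ### Channels and tangents with finite output -/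

section Kernels

variable {X Y : Type*} [MeasurableSpace X] [MeasurableSpace Y]

lemma IsTangent.comp {Δ : X → Y → ℝ} (h : IsTangent Δ) {ρ : X → X} (hρ : Measurable ρ) :
    IsTangent fun x => Δ (ρ x) := by
  obtain ⟨c, Ψ₁, Ψ₂, h₁, h₂, hΔ⟩ := h
  exact ⟨c, Ψ₁.comap ρ hρ, Ψ₂.comap ρ hρ, inferInstance, inferInstance, fun x y => hΔ _ _⟩

variable [MeasurableSingletonClass Y]

lemma measurable_prob (Φ : Kernel X Y) (y : Y) : Measurable fun x => prob Φ x y :=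
  (Kernel.measurable_coe Φ (measurableSet_singleton y)).ennreal_toReal

lemma IsTangent.measurable {Δ : X → Y → ℝ} (h : IsTangent Δ) (y : Y) :
    Measurable fun x => Δ x y := by
  obtain ⟨c, Ψ₁, Ψ₂, -, -, hΔ⟩ := h
  simp_rw [hΔ]
  exact ((measurable_prob Ψ₁ y).sub (measurable_prob Ψ₂ y)).const_mul c

variable [Fintype Y]

lemma sum_prob (Φ : Kernel X Y) [IsMarkovKernel Φ] (x : X) : ∑ y, prob Φ x y = 1 := by
  simp [prob]

lemma IsTangent.sum_eq_zero {Δ : X → Y → ℝ} (h : IsTangent Δ) (x : X) : ∑ y, Δ x y = 0 := by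
  obtain ⟨c, Ψ₁, Ψ₂, h₁, h₂, hΔ⟩ := h
  simp_rw [hΔ]
  rw [← Finset.mul_sum, Finset.sum_sub_distrib, sum_prob, sum_prob, sub_self, mul_zero]

/-- Transition probabilities that are measurable in the input define a channel. -/
lemma exists_kernel_of_weights (W : X → Y → ℝ) (hW : ∀ y, Measurable fun x => W x y)
    (h0 : ∀ x y, 0 ≤ W x y) (h1 : ∀ x, ∑ y, W x y = 1) :
    ∃ Λ : Kernel X Y, IsMarkovKernel Λ ∧ ∀ x y, prob Λ x y = W x y := by
  classical
  refine ⟨⟨fun x => ∑ y, ENNReal.ofReal (W x y) • Measure.dirac y, ?_⟩, ⟨fun x => ⟨?_⟩⟩,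
    fun x y => ?_⟩
  · refine Measure.measurable_of_measurable_coe _ fun s hs => ?_
    simp only [Measure.coe_finsetSum, Finset.sum_apply, Measure.smul_apply, smul_eq_mul]
    exact Finset.measurable_fun_sum _ fun y _ => (hW y).ennreal_ofReal.mul_const _
  · simp only [Kernel.coe_mk, Measure.coe_finsetSum, Finset.sum_apply, Measure.smul_apply,
      smul_eq_mul, measure_univ, mul_one]
    rw [← ENNReal.ofReal_sum_of_nonneg fun y _ => h0 x y, h1, ENNReal.ofReal_one]
  · simp only [prob, Kernel.coe_mk, Measure.real, Measure.coe_finsetSum, Finset.sum_apply,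
      Measure.smul_apply, smul_eq_mul]
    rw [Finset.sum_eq_single y]
    · simp [h0]
    · intro y' _ hy
      simp [hy]
    · simp

end Kernels

/-! ### Lattice cells and discretization maps -/

section Discretization

variable {d : ℕ}

lemma measurable_latticeIndex (t : ℝ) :
    Measurable (latticeIndex t : EuclideanSpace ℝ (Fin d) → Fin d → ℤ) := by
  refine measurable_pi_lambda _ fun i => ?_
  simp only [latticeIndex, round_eq]
  refine Int.measurable_floor.comp ?_
  fun_prop

lemma latticeIndex_latticePoint {t : ℝ} (ht : 0 < t) (m : Fin d → ℤ) :
    latticeIndex t (latticePoint t m) = m := by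
  ext i
  simp [latticeIndex, latticePoint, ht.ne']

lemma norm_sub_le_of_latticeIndex_eq {t : ℝ} (ht : 0 < t) {x x' : EuclideanSpace ℝ (Fin d)}
    (h : latticeIndex t x = latticeIndex t x') : ‖x - x'‖ ≤ d * t := by
  have h1 : ∀ i, |(x - x') i| ≤ t := fun i => by
    have h2 := abs_sub_round (x i / t)
    have h3 := abs_sub_round (x' i / t)
    rw [show round (x i / t) = round (x' i / t) from congrFun h i] at h2
    have h4 : |x i / t - x' i / t| ≤ 1 := by
      rw [abs_le] at *; constructor <;> linarith [h2.1, h2.2, h3.1, h3.2]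
    rw [← sub_div, abs_div, abs_of_pos ht, div_le_one ht] at h4
    exact h4
  rw [EuclideanSpace.norm_eq]
  refine Real.sqrt_le_iff.2 ⟨by positivity, ?_⟩
  have h5 : ∑ i, ‖(x - x') i‖ ^ 2 ≤ ∑ _i : Fin d, t ^ 2 :=
    Finset.sum_le_sum fun i _ => by rw [Real.norm_eq_abs]; gcongr; exact h1 i
  refine h5.trans ?_
  simp only [Finset.sum_const, Finset.card_univ, Fintype.card_fin, nsmul_eq_mul]
  rw [mul_pow]
  gcongr
  rcases Nat.eq_zero_or_pos d with rfl | hd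
  · simp
  · have : (1 : ℝ) ≤ d := by exact_mod_cast hd
    nlinarith

lemma finite_latticeIndex_image {K : Set (EuclideanSpace ℝ (Fin d))} (hK : Bornology.IsBounded K)
    (t : ℝ) : (latticeIndex t '' K).Finite := by
  obtain ⟨R, hR⟩ := hK.exists_norm_le
  refine (Set.finite_Icc (fun _ : Fin d => ⌊-(R / |t|)⌋ - 1) (fun _ => ⌈R / |t|⌉ + 1)).subset ?_
  rintro _ ⟨x, hx, rfl⟩
  have h1 : ∀ i, |x i / t| ≤ R / |t| := fun i => by
    rw [abs_div]
    gcongr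
    exact (PiLp.norm_apply_le x i).trans (hR x hx)
  refine ⟨fun i => ?_, fun i => ?_⟩
  all_goals
    have h2 := abs_le.1 (h1 i)
    have h3 := abs_le.1 (abs_sub_round (x i / t))
    have h4 := Int.floor_le (-(R / |t|))
    have h5 := Int.le_ceil (R / |t|)
    simp only [latticeIndex]
    rw [← Int.cast_le (R := ℝ)]
    push_cast
    linarith

lemma one_le_latticeCount {K : Set (EuclideanSpace ℝ (Fin d))} (hK : Bornology.IsBounded K)
    (hne : K.Nonempty) (t : ℝ) : 1 ≤ latticeCount K t :=
  (Set.ncard_pos (finite_latticeIndex_image hK t)).2 (hne.image _)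

/-- For `t > 0` there is a lattice discretization; it factors through the lattice index. -/
lemma exists_isLatticeDiscretization (K : Set (EuclideanSpace ℝ (Fin d))) [Nonempty K] {t : ℝ}
    (ht : 0 < t) : ∃ r : (Fin d → ℤ) → K,
      IsLatticeDiscretization K t fun x => r (latticeIndex t (x : EuclideanSpace ℝ (Fin d))) := by
  classical
  have h : ∀ m : Fin d → ℤ, ∃ k : K, (∀ x : K, latticeIndex t (x : EuclideanSpace ℝ (Fin d)) = m →
      latticeIndex t (k : EuclideanSpace ℝ (Fin d)) = m) ∧
      (latticePoint t m ∈ K → (k : EuclideanSpace ℝ (Fin d)) = latticePoint t m) := fun m => by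
    by_cases h1 : latticePoint t m ∈ K
    · exact ⟨⟨_, h1⟩, fun _ _ => latticeIndex_latticePoint ht m, fun _ => rfl⟩
    · by_cases h2 : ∃ x : K, latticeIndex t (x : EuclideanSpace ℝ (Fin d)) = m
      · obtain ⟨x, hx⟩ := h2
        exact ⟨x, fun _ _ => hx, fun h => absurd h h1⟩
      · exact ⟨Classical.arbitrary K, fun x hx => absurd ⟨x, hx⟩ h2, fun h => absurd h h1⟩
  choose r hr hr' using h
  refine ⟨r, ⟨?_, fun x => hr _ x rfl, fun x x' hx => by simp only [hx], fun x => hr' _⟩⟩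
  exact (measurable_of_countable r).comp ((measurable_latticeIndex t).comp measurable_subtype_coe)

end Discretization

/-! ### Score identities and moment bounds -/

section Score

variable {Y : Type*}

lemma mul_score {p δ : Y → ℝ} (h : ∀ y, p y = 0 → δ y = 0) (y : Y) : p y * (δ y / p y) = δ y := by
  by_cases hp : p y = 0
  · rw [hp, h y hp, zero_mul]
  · field_simp

lemma mul_score_sq (p δ : Y → ℝ) (y : Y) : p y * (δ y / p y) ^ 2 = δ y ^ 2 / p y := by
  by_cases hp : p y = 0
  · simp [hp]
  · field_simp

/-- Scores add over independent factors; this exhibits the tangent of the product as a sum of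
independent variables. -/
lemma tangentPow_eq_tensorPow_mul {X : Type*} {φ Δ : X → Y → ℝ}
    (h : ∀ x y, φ x y = 0 → Δ x y = 0) (n : ℕ) (x : Fin n → X) (y : Fin n → Y) :
    tangentPow φ Δ n x y =
      (∏ i, φ (x i) (y i)) * ∑ i, Δ (x i) (y i) / φ (x i) (y i) := by
  rw [tangentPow, Finset.mul_sum]
  refine Finset.sum_congr rfl fun i _ => ?_
  rw [← Finset.mul_prod_erase _ _ (Finset.mem_univ i), mul_right_comm, mul_score (h (x i))]

lemma sum_mul_le_of_pow_le [Fintype Y] {p : Y → ℝ} (L : Y → ℝ) (k : ℕ) (hk : k ≤ 4)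
    (hp : ∀ y, 0 ≤ p y) (h1 : ∑ y, p y = 1) :
    ∑ y, p y * |L y| ^ k ≤ 1 + ∑ y, p y * L y ^ 4 := by
  rw [← h1, ← Finset.sum_add_distrib]
  refine Finset.sum_le_sum fun y _ => ?_
  rw [← mul_one_add]
  refine mul_le_mul_of_nonneg_left ?_ (hp y)
  have h4 : L y ^ 4 = |L y| ^ 4 := by rw [← abs_pow, abs_of_nonneg (by positivity)]
  rw [h4]
  rcases le_total |L y| 1 with h | h
  · have := pow_le_one₀ (n := k) (abs_nonneg (L y)) h
    have := pow_nonneg (abs_nonneg (L y)) 4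
    linarith
  · have := pow_le_pow_right₀ h hk
    linarith

end Score

/-! ### Simulation of a product channel at a fixed input -/

section Channels

variable {X Y : Type*} [MeasurableSpace X] [MeasurableSpace Y] [MeasurableSingletonClass Y]
  [Fintype Y]

/-- Under a uniform fourth moment bound, a product channel together with its tangent is simulated,
at each input, by a Gaussian shift with slightly larger Fisher information. -/
theorem exists_simulation_tensorPow [Nonempty X] (Φ : Kernel X Y) [IsMarkovKernel Φ]
    (Δ : X → Y → ℝ) (hΔ : IsTangent Δ) (hac : ∀ x y, prob Φ x y = 0 → Δ x y = 0)
    (hL : BddAbove (Set.range fun x => scoreFourthMoment (prob Φ x) (Δ x))) :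
    0 ≤ gMin Φ Δ ∧ ∃ C : ℝ, 0 < C ∧ ∀ (n : ℕ) (ε s : ℝ), 0 < n → 0 < ε →
      n * (1 + ε) * gMin Φ Δ ≤ s → ∀ x : Fin n → X, ∃ w : (Fin n → Y) → ℝ → ℝ,
        IsRandomization w ∧
        ∑ y, |tensorPow (prob Φ) n x y - ∫ z, w y z ∂gaussianReal 0 1| ≤ C / √(ε * n) ∧
        ∑ y, |tangentPow (prob Φ) Δ n x y - ∫ z, w y z * (√s * z) ∂gaussianReal 0 1| ≤
          C * (√n / (ε * n) ^ (1 / 4 : ℝ)) := by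
  obtain ⟨M, hM⟩ := hL
  obtain ⟨C, hC0, hC⟩ := exists_product_le_gaussian
  set J := gMin Φ Δ with hJ
  set L : X → Y → ℝ := fun x y => Δ x y / prob Φ x y with hLdef
  have hp : ∀ x y, 0 ≤ prob Φ x y := fun x y => measureReal_nonneg
  have hM' : ∀ x, ∑ y, prob Φ x y * L x y ^ 4 ≤ M := fun x => hM ⟨x, rfl⟩
  have hfisher : ∀ x, fisherInfo (prob Φ x) (Δ x) = ∑ y, prob Φ x y * L x y ^ 2 := fun x =>
    Finset.sum_congr rfl fun y _ => (mul_score_sq _ _ y).symm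
  have hJx : ∀ x, ∑ y, prob Φ x y * L x y ^ 2 ≤ J := fun x => by
    rw [← hfisher]
    refine le_ciSup (f := fun x => fisherInfo (prob Φ x) (Δ x)) ⟨1 + M, ?_⟩ x
    rintro _ ⟨x, rfl⟩
    simp only [hfisher]
    have := sum_mul_le_of_pow_le (L x) 2 (by norm_num) (hp x) (sum_prob Φ x)
    simp only [sq_abs] at this
    linarith [hM' x]
  obtain ⟨x₀⟩ := ‹Nonempty X›
  have hJ0 : 0 ≤ J := le_trans
    (Finset.sum_nonneg fun y _ => mul_nonneg (hp x₀ y) (sq_nonneg _)) (hJx x₀)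
  have hM0 : 0 ≤ M := le_trans
    (Finset.sum_nonneg fun y _ => mul_nonneg (hp x₀ y) (by positivity)) (hM' x₀)
  have hY : Nonempty Y := by
    by_contra h
    rw [not_nonempty_iff] at h
    simpa using sum_prob Φ x₀
  -- `1 + M` bounds the third absolute moments, `√J ^ 3` the cubes of the standard deviations.
  set R := 1 + M + √J ^ 3 with hR
  have hR0 : 0 ≤ R := by positivity
  have hJ3 : 0 ≤ √J ^ 3 := by positivity
  refine ⟨hJ0, C * R / J + √J + 1, by positivity, fun n ε s hn hε hs x => ?_⟩
  have hn' : (0 : ℝ) < n := Nat.cast_pos.2 hn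
  have hq : 0 < √n / (ε * n) ^ (1 / 4 : ℝ) := by positivity
  have hz : Integrable (fun z : ℝ => √s * z) (gaussianReal 0 1) := by
    simpa using (integrable_pow_gaussianReal 1).const_mul (√s)
  have hbound := hC n (fun i => prob Φ (x i)) (fun i => L (x i)) J R ε s hn hJ0 hε hs
    (fun i => hp _) (fun i => sum_prob Φ _)
    (fun i => by simp only [hLdef, mul_score (hac (x i))]; exact hΔ.sum_eq_zero _)
    (fun i => by
      have := sum_mul_le_of_pow_le (L (x i)) 3 (by norm_num) (hp (x i)) (sum_prob Φ (x i))
      linarith [hM' (x i)])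
    (fun i => hJx _) (by linarith)
  obtain ⟨w, hw, h1, h2⟩ := exists_isRandomization_of_le (gaussianReal 0 1) (fun z => √s * z)
    (by fun_prop) hz (tensorPow (prob Φ) n x) (tangentPow (prob Φ) Δ n x)
    (D := (C * R / J + √J) * (√n / (ε * n) ^ (1 / 4 : ℝ)))
    -- Any positive `E₁` is admissible, so the required rate is simply inserted; the summand `1`
    -- also secures `D < E₂`.
    (E₁ := (C * R / J + √J + 1) / √(ε * n))
    (E₂ := (C * R / J + √J + 1) * (√n / (ε * n) ^ (1 / 4 : ℝ)))
    (by positivity) (by positivity) (mul_lt_mul_of_pos_right (lt_add_one _) hq)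
    (fun α β B hβ => by
      simp_rw [tangentPow_eq_tensorPow_mul hac]
      exact hbound α β B hβ)
  exact ⟨w, hw, h1, h2⟩

end Channels

/-! ### Programs as Gaussian integrals -/

section Programs

variable {A B : Type*} [MeasurableSpace A] [MeasurableSpace B]

lemma runProgram_programDensity (Λ : Kernel (A × ℝ) B) (a : A) (b : B) :
    runProgram Λ programDensity a b = ∫ z, prob Λ (a, z) b ∂gaussianReal 0 1 := by
  rw [integral_gaussianReal_eq_integral_smul one_ne_zero]
  simp only [runProgram, programDensity, smul_eq_mul, mul_comm]

lemma runProgram_programTangent (Λ : Kernel (A × ℝ) B) (s : ℝ) (a : A) (b : B) :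
    runProgram Λ (programTangent s) a b =
      ∫ z, prob Λ (a, z) b * (√s * z) ∂gaussianReal 0 1 := by
  rw [integral_gaussianReal_eq_integral_smul one_ne_zero]
  refine integral_congr_ae (ae_of_all _ fun z => ?_)
  simp only [programTangent, gaussianTangent, smul_eq_mul, sub_zero, NNReal.coe_one, div_one]
  ring

end Programs

/-! ### Convergence of the discretizations and the main theorem -/

section Main

variable {d : ℕ}

/-- A discretization moves points by at most `d * t`, so the modulus of continuity controls the `ℓ¹`
change uniformly. -/
lemma tendsto_cbNorm_of_modulus {K : Set (EuclideanSpace ℝ (Fin d))} {Y : Type*} [Fintype Y]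
    [MeasurableSpace Y] (D : K → Y → ℝ) (hD : ∀ y, Measurable fun x => D x y) (ρ : ℝ → K → K)
    (hρ : ∀ t, 0 < t → IsLatticeDiscretization K t (ρ t)) (f : ℝ → ℝ)
    (hf : Tendsto f (𝓝[>] 0) (𝓝 0))
    (hmod : ∀ x x' : K, ∑ y, |D x y - D x' y| ≤
      f ‖(x : EuclideanSpace ℝ (Fin d)) - (x' : EuclideanSpace ℝ (Fin d))‖) :
    Tendsto (fun t => cbNorm fun x y => D (ρ t x) y - D x y) (𝓝[>] 0) (𝓝 0) := by
  rw [ENNReal.tendsto_nhds_zero]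
  intro e he
  obtain ⟨δ, hδ0, hδ⟩ := ENNReal.lt_iff_exists_nnreal_btwn.1 he
  have hδ0' : (0 : ℝ) < δ := by exact_mod_cast hδ0
  obtain ⟨r, hr0, hr⟩ := mem_nhdsGT_iff_exists_Ioo_subset.1 (hf.eventually_lt_const hδ0')
  have hr0' : 0 < r := hr0
  have hr1 : 0 < r / (d + 1) := by positivity
  filter_upwards [Ioo_mem_nhdsGT hr1] with t ht
  have hdt : d * t < r := by
    have h1 := ht.2
    rw [lt_div_iff₀ (by positivity)] at h1
    nlinarith [ht.1]
  have hρt := hρ t ht.1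
  refine (cbNorm_le_ofReal _ (E := δ) (fun x => ?_)
    fun y => ((hD y).comp hρt.measurable).sub (hD y)).trans ?_
  -- Fixed points are treated apart because the limit of `f` at `0` from the right says nothing
  -- about `f 0`.
  · by_cases hx : ρ t x = x
    · simp [hx]
    · refine (hmod _ _).trans (le_of_lt (hr ⟨?_, ?_⟩))
      · rw [norm_pos_iff, sub_ne_zero]
        exact fun h => hx (Subtype.ext h)
      · exact (norm_sub_le_of_latticeIndex_eq ht.1 (hρt.index_eq x)).trans_lt hdt
  · rw [ENNReal.ofReal_coe_nnreal]
    exact hδ.le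

lemma cbNorm_of_isEmpty {X Y : Type*} [MeasurableSpace X] [MeasurableSpace Y] [Fintype Y]
    [IsEmpty X] (D : X → Y → ℝ) : cbNorm D = 0 := by
  have := cbNorm_le_ofReal D (E := 0) (fun x => isEmptyElim x)
    fun y => Subsingleton.measurable
  simpa using this

end Main

theorem mainTheorem8 {d : ℕ} (K : Set (EuclideanSpace ℝ (Fin d))) (hK : IsCompact K)
    {Y : Type*} [Fintype Y] [MeasurableSpace Y] [MeasurableSingletonClass Y]
    (Φ : Kernel K Y) [IsMarkovKernel Φ] (Δ : K → Y → ℝ) (hΔ : IsTangent Δ)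
    -- the score `Δ(y|x) / Φ(y|x)` exists, with fourth moments bounded uniformly in the input
    (hac : ∀ x y, prob Φ x y = 0 → Δ x y = 0)
    (hL : BddAbove (Set.range fun x => scoreFourthMoment (prob Φ x) (Δ x)))
    (f : ℝ → ℝ) (hf : Tendsto f (𝓝[>] 0) (𝓝 0))
    (hmod : ∀ x x' : K, max (∑ y, |prob Φ x y - prob Φ x' y|) (∑ y, |Δ x y - Δ x' y|) ≤
      f ‖(x : EuclideanSpace ℝ (Fin d)) - (x' : EuclideanSpace ℝ (Fin d))‖) :
    ∃ (Φt : ℝ → Kernel K Y) (Δt : ℝ → K → Y → ℝ) (C : ℝ → ℝ),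
      -- the channels and tangents with index `t` are lattice discretizations
      (∀ t, 0 < t → IsMarkovKernel (Φt t) ∧ IsTangent (Δt t) ∧
        ∃ ρ : K → K, IsLatticeDiscretization K t ρ ∧
          ∀ x, Φt t x = Φ (ρ x) ∧ Δt t x = Δ (ρ x)) ∧
      -- convergence in cb-norm
      Tendsto (fun t => cbNorm fun x y => prob (Φt t) x y - prob Φ x y) (𝓝[>] 0) (𝓝 0) ∧
      Tendsto (fun t => cbNorm fun x y => Δt t x y - Δ x y) (𝓝[>] 0) (𝓝 0) ∧
      -- the constants have a finite limit
      (∃ C₀ : ℝ, Tendsto C (𝓝[>] 0) (𝓝 C₀)) ∧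
      -- asymptotic tangent simulation by Gaussian shifts
      ∀ ε c : ℝ, 0 < ε → 0 < c → ∀ t : ℝ, 0 < t → ∀ n : ℕ, 0 < n →
        ∃ Λ : Kernel ((Fin n → K) × ℝ) (Fin n → Y), IsMarkovKernel Λ ∧
          cbNorm (fun x y => tensorPow (prob (Φt t)) n x y - runProgram Λ programDensity x y) ≤
            ENNReal.ofReal (C t / Real.sqrt (ε * n)) ∧
          ENNReal.ofReal (1 / Real.sqrt n) *
            cbNorm (fun x y => tangentPow (prob (Φt t)) (Δt t) n x y -
              runProgram Λ
                (programTangent (n * (1 + latticeCount K t * ε) * (gMin Φ Δ + c))) x y) ≤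
            ENNReal.ofReal (C t / (ε * n) ^ (1 / 4 : ℝ)) := by
  rcases isEmpty_or_nonempty K with hE | hE
  · refine ⟨fun _ => Φ, fun _ => Δ, fun _ => 1, fun t _ => ⟨inferInstance, hΔ, id,
      ⟨measurable_id, fun x => isEmptyElim x, fun x => isEmptyElim x, fun x => isEmptyElim x⟩,
      fun x => isEmptyElim x⟩, ?_, ?_, ⟨1, tendsto_const_nhds⟩, fun ε c _ _ t _ n hn => ?_⟩
    · simp [cbNorm_of_isEmpty]
    · simp [cbNorm_of_isEmpty]
    · have : Nonempty (Fin n) := ⟨⟨0, hn⟩⟩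
      exact ⟨0, ⟨fun x => isEmptyElim x.1⟩, by simp [cbNorm_of_isEmpty],
        by simp [cbNorm_of_isEmpty]⟩
  obtain ⟨hJ0, C, hC0, hC⟩ := exists_simulation_tensorPow Φ Δ hΔ hac hL
  have hr : ∀ t : ℝ, ∃ r : (Fin d → ℤ) → K, 0 < t → IsLatticeDiscretization K t
      fun x => r (latticeIndex t (x : EuclideanSpace ℝ (Fin d))) := fun t => by
    by_cases ht : 0 < t
    · obtain ⟨r, hr⟩ := exists_isLatticeDiscretization K ht
      exact ⟨r, fun _ => hr⟩
    · exact ⟨fun _ => Classical.arbitrary K, fun h => absurd h ht⟩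
  choose r hr using hr
  have hidx : ∀ t, Measurable fun x : K => latticeIndex t (x : EuclideanSpace ℝ (Fin d)) :=
    fun t => (measurable_latticeIndex t).comp measurable_subtype_coe
  set ρ : ℝ → K → K := fun t x => r t (latticeIndex t (x : EuclideanSpace ℝ (Fin d))) with hρdef
  have hρm : ∀ t, Measurable (ρ t) := fun t => (measurable_of_countable (r t)).comp (hidx t)
  refine ⟨fun t => Φ.comap (ρ t) (hρm t), fun t x => Δ (ρ t x), fun _ => C,
    fun t ht => ⟨inferInstance, hΔ.comp (hρm t), ρ t, hr t ht, fun x => ⟨rfl, rfl⟩⟩,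
    tendsto_cbNorm_of_modulus (prob Φ) (measurable_prob Φ) ρ hr f hf
      fun x x' => (le_max_left _ _).trans (hmod x x'),
    tendsto_cbNorm_of_modulus Δ hΔ.measurable ρ hr f hf
      fun x x' => (le_max_right _ _).trans (hmod x x'),
    ⟨C, tendsto_const_nhds⟩, fun ε c hε hc t ht n hn => ?_⟩
  have hn' : (0 : ℝ) < n := Nat.cast_pos.2 hn
  set s : ℝ := n * (1 + latticeCount K t * ε) * (gMin Φ Δ + c) with hs
  -- One cell already suffices: the pointwise simulation needs only the factor `1 + ε`.
  have hk : (1 : ℝ) ≤ latticeCount K t := by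
    exact_mod_cast one_le_latticeCount hK.isBounded (Set.nonempty_coe_sort.1 hE) t
  have hs' : n * (1 + ε) * gMin Φ Δ ≤ s := by
    rw [hs]
    have : ε ≤ latticeCount K t * ε := le_mul_of_one_le_left hε.le hk
    gcongr
    linarith
  -- Choosing by index string rather than by input leaves countably many choices, which makes the
  -- kernel jointly measurable.
  choose w hw h1 h2 using fun m : Fin n → Fin d → ℤ => hC n ε s hn hε hs' fun i => r t (m i)
  have hidxn : Measurable fun (x : Fin n → K) i =>
      latticeIndex t (x i : EuclideanSpace ℝ (Fin d)) :=
    measurable_pi_lambda _ fun i => (hidx t).comp (measurable_pi_apply i)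
  obtain ⟨Λ, hΛ, hΛp⟩ := exists_kernel_of_weights
    (fun (a : (Fin n → K) × ℝ) y =>
      w (fun i => latticeIndex t (a.1 i : EuclideanSpace ℝ (Fin d))) y a.2)
    (fun y => (measurable_from_prod_countable_right
      (f := fun b : (Fin n → Fin d → ℤ) × ℝ => w b.1 y b.2)
      fun m => (hw m).measurable y).comp ((hidxn.comp measurable_fst).prodMk measurable_snd))
    (fun a y => (hw _).nonneg y _) (fun a => (hw _).sum_eq_one _)
  refine ⟨Λ, hΛ, ?_, ?_⟩
  · refine cbNorm_le_ofReal _ (fun x => ?_) fun y => ?_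
    · simp_rw [runProgram_programDensity, hΛp]
      exact h1 _
    · simp_rw [runProgram_programDensity, hΛp]
      exact (measurable_of_countable fun m : Fin n → Fin d → ℤ =>
        tensorPow (prob Φ) n (fun i => r t (m i)) y - ∫ z, w m y z ∂gaussianReal 0 1).comp hidxn
  · have hcb : cbNorm (fun x y => tangentPow (prob (Φ.comap (ρ t) (hρm t)))
        (fun x => Δ (ρ t x)) n x y - runProgram Λ (programTangent s) x y) ≤
        ENNReal.ofReal (C * (√n / (ε * n) ^ (1 / 4 : ℝ))) := by
      refine cbNorm_le_ofReal _ (fun x => ?_) fun y => ?_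
      · simp_rw [runProgram_programTangent, hΛp]
        exact h2 _
      · simp_rw [runProgram_programTangent, hΛp]
        exact (measurable_of_countable fun m : Fin n → Fin d → ℤ =>
          tangentPow (prob Φ) Δ n (fun i => r t (m i)) y -
            ∫ z, w m y z * (√s * z) ∂gaussianReal 0 1).comp hidxn
    refine (mul_le_mul_right hcb _).trans (le_of_eq ?_)
    rw [← ENNReal.ofReal_mul (by positivity)]
    congr 1
    field_simp
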